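/- Consider the plant $x_{k+1}=Ax_k+Bu_k+w_k$ with $x_0=0$, $x_k\in\mathbb R^n$, $u_k\in\mathbb R^m$, where the $w_k$ are i.i.d. $N(0,W)$ with $W\succ0$. Let $Q\succ0$, $R\succ0$. The cost of a controller is $$J=\limsup_{T\to\infty}\frac1T\,\mathbb E\Big[\sum_{k=0}^{T-1}x_k^TQx_k+u_k^TRu_k\Big]\in[0,\infty].$$ Let $K_0,K_1\in\mathbb R^{m\times n}$ be stabilizing gains, i.e. the spectral radii of $A+BK_0$ and $A+BK_1$ are less than $1$. Let $J^{K_1}$ be the cost of the linear controller $u_k=K_1x_k$. For $M\in\mathbb R$ and $t\in\mathbb N$, let $J^{K_1,M,t}$ be the cost of the following switched controller, which keeps a counter $\xi\in\mathbb N$, initially $0$. At each step with current state $x$: if $\xi>0$, apply $u=K_0x$; if $\xi=0$ and $\|x\|\ge M$, set $\xi:=t$ and apply $u=K_0x$; otherwise apply $u=K_1x$. Then replace $\xi$ by $\max\{\xi-1,0\}$. Let $0<\rho<1$ and $P\succ0$ satisfy $(A+BK_1)^TP(A+BK_1)\prec\rho P$ (such $\rho,P$ exist because $K_1$ is stabilizing).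 Put $$\tilde W=\sum_{\tau=0}^\infty (A+BK_0)^\tau W\big((A+BK_0)^\tau\big)^T,\qquad c=\frac{(1-\rho^{1/4})^2}{16\,\|\tilde W\|\,\|P\|\,\|P^{-1}\|},$$ where $\|\cdot\|$ is the Euclidean norm of vectors and the induced operator norm of matrices. Then $J^{K_1}<\infty$, and, with all data except $M$ and $t$ held fixed, $$J^{K_1,M,t}-J^{K_1}=O\big(t^{1/4}\exp(-cM^2)\big)\qquad\text{as } M\to\infty,\ t\to\infty,\ t^{1/4}\exp(-cM^2)\to0 .$$ That is, there are constants $C$, $M_0$, $t_0$ and $\varepsilon>0$ such that for all $M\ge M_0$ and all integers $t\ge t_0$ with $t^{1/4}\exp(-cM^2)<\varepsilon$, one has $J^{K_1,M,t}<\infty$ and $|J^{K_1,M,t}-J^{K_1}|\le C\,t^{1/4}\exp(-cM^2)$. -/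

import Mathlib

open MeasureTheory ProbabilityTheory Filter Topology Asymptotics
open scoped ENNReal Matrix

noncomputable section

namespace SwitchedLQR

/-- Action of a matrix on Euclidean vectors. -/
abbrev act {p q : ℕ} (A : Matrix (Fin p) (Fin q) ℝ) (x : EuclideanSpace ℝ (Fin q)) :
    EuclideanSpace ℝ (Fin p) :=
  Matrix.toEuclideanLin A x

/-- The quadratic form `xᵀ Q x`. -/
def quad {p : ℕ} (Q : Matrix (Fin p) (Fin p) ℝ) (x : EuclideanSpace ℝ (Fin p)) : ℝ :=
  x.ofLp ⬝ᵥ (Q *ᵥ x.ofLp)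

/-- The operator norm of a square matrix induced by the Euclidean norm (largest singular value). -/
def opNorm {p : ℕ} (A : Matrix (Fin p) (Fin p) ℝ) : ℝ :=
  ‖Matrix.toEuclideanCLM (n := Fin p) (𝕜 := ℝ) A‖

/-- The gain `K` is stabilizing for `(A, B)`: the spectral radius of `A + B K`, computed over all
complex eigenvalues, is less than `1`. -/
def IsStabilizing {n m : ℕ} (A : Matrix (Fin n) (Fin n) ℝ) (B : Matrix (Fin n) (Fin m) ℝ)
    (K : Matrix (Fin m) (Fin n) ℝ) : Prop :=
  spectralRadius ℂ ((A + B * K).map (algebraMap ℝ ℂ)) < 1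

/-- One call of the switching logic on the current state `x` and counter value `ξ`: it returns the
control input and the next counter value. (Subtraction on `ℕ` is `max (ξ - 1) 0`.) -/
def switchLogic {n m : ℕ} (K₀ K₁ : Matrix (Fin m) (Fin n) ℝ) (M : ℝ) (t : ℕ)
    (x : EuclideanSpace ℝ (Fin n)) (ξ : ℕ) : EuclideanSpace ℝ (Fin m) × ℕ :=
  if 0 < ξ then (act K₀ x, ξ - 1)
  else if M ≤ ‖x‖ then (act K₀ x, t - 1)
  else (act K₁ x, ξ - 1)

/-- State and counter at time `k` of the plant `x⁺ = A x + B u + w` under the switched controller,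
along the noise sequence `w`, started from the zero state and the zero counter. -/
def switchedTraj {n m : ℕ} (A : Matrix (Fin n) (Fin n) ℝ) (B : Matrix (Fin n) (Fin m) ℝ)
    (K₀ K₁ : Matrix (Fin m) (Fin n) ℝ) (M : ℝ) (t : ℕ) (w : ℕ → EuclideanSpace ℝ (Fin n)) :
    ℕ → EuclideanSpace ℝ (Fin n) × ℕ
  | 0 => (0, 0)
  | k + 1 =>
    let s := switchedTraj A B K₀ K₁ M t w k
    let c := switchLogic K₀ K₁ M t s.1 s.2
    (act A s.1 + act B c.1 + w k, c.2)

/-- The input applied at time `k` by the switched controller. -/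
def switchedInput {n m : ℕ} (A : Matrix (Fin n) (Fin n) ℝ) (B : Matrix (Fin n) (Fin m) ℝ)
    (K₀ K₁ : Matrix (Fin m) (Fin n) ℝ) (M : ℝ) (t : ℕ) (w : ℕ → EuclideanSpace ℝ (Fin n))
    (k : ℕ) : EuclideanSpace ℝ (Fin m) :=
  (switchLogic K₀ K₁ M t (switchedTraj A B K₀ K₁ M t w k).1
    (switchedTraj A B K₀ K₁ M t w k).2).1

/-- State at time `k` of the plant `x⁺ = A x + B u + w` under the linear controller `u = K x`,
started from the zero state. -/
def linearTraj {n m : ℕ} (A : Matrix (Fin n) (Fin n) ℝ) (B : Matrix (Fin n) (Fin m) ℝ)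
    (K : Matrix (Fin m) (Fin n) ℝ) (w : ℕ → EuclideanSpace ℝ (Fin n)) :
    ℕ → EuclideanSpace ℝ (Fin n)
  | 0 => 0
  | k + 1 =>
    act A (linearTraj A B K w k) + act B (act K (linearTraj A B K w k)) + w k

/-- The infinite-horizon quadratic cost
`limsup_{T → ∞} (1/T) 𝔼 [∑_{k < T} xₖᵀ Q xₖ + uₖᵀ R uₖ]` of a state process `x` and an input
process `u`, as an extended nonnegative number (all summands are nonnegative for positive
semidefinite `Q` and `R`), so that a divergent cost is `∞`. -/
def lqCost {n m : ℕ} {Ω : Type*} [MeasurableSpace Ω] (μ : Measure Ω)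
    (Q : Matrix (Fin n) (Fin n) ℝ) (R : Matrix (Fin m) (Fin m) ℝ)
    (x : ℕ → Ω → EuclideanSpace ℝ (Fin n)) (u : ℕ → Ω → EuclideanSpace ℝ (Fin m)) : ℝ≥0∞ :=
  limsup (fun T : ℕ => (T : ℝ≥0∞)⁻¹ *
    ∫⁻ ω, ENNReal.ofReal (∑ k ∈ Finset.range T, (quad Q (x k ω) + quad R (u k ω))) ∂μ) atTop

/-- `J^{K₁, M, t}`: the cost of the switched controller. -/
def switchedCost {n m : ℕ} {Ω : Type*} [MeasurableSpace Ω] (μ : Measure Ω)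
    (A : Matrix (Fin n) (Fin n) ℝ) (B : Matrix (Fin n) (Fin m) ℝ)
    (Q : Matrix (Fin n) (Fin n) ℝ) (R : Matrix (Fin m) (Fin m) ℝ)
    (K₀ K₁ : Matrix (Fin m) (Fin n) ℝ) (w : ℕ → Ω → EuclideanSpace ℝ (Fin n))
    (M : ℝ) (t : ℕ) : ℝ≥0∞ :=
  lqCost μ Q R (fun k ω => (switchedTraj A B K₀ K₁ M t (fun j => w j ω) k).1)
    (fun k ω => switchedInput A B K₀ K₁ M t (fun j => w j ω) k)

/-- `J^{K}`: the cost of the linear controller `u = K x`. -/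
def linearCost {n m : ℕ} {Ω : Type*} [MeasurableSpace Ω] (μ : Measure Ω)
    (A : Matrix (Fin n) (Fin n) ℝ) (B : Matrix (Fin n) (Fin m) ℝ)
    (Q : Matrix (Fin n) (Fin n) ℝ) (R : Matrix (Fin m) (Fin m) ℝ)
    (K : Matrix (Fin m) (Fin n) ℝ) (w : ℕ → Ω → EuclideanSpace ℝ (Fin n)) : ℝ≥0∞ :=
  lqCost μ Q R (fun k ω => linearTraj A B K (fun j => w j ω) k)
    (fun k ω => act K (linearTraj A B K (fun j => w j ω) k))

/-- `W̃ = ∑_{τ ≥ 0} (A + B K₀)^τ W ((A + B K₀)^τ)ᵀ`; the series converges when `K₀` is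
stabilizing. -/
def stationaryCov {n m : ℕ} (A : Matrix (Fin n) (Fin n) ℝ) (B : Matrix (Fin n) (Fin m) ℝ)
    (K₀ : Matrix (Fin m) (Fin n) ℝ) (W : Matrix (Fin n) (Fin n) ℝ) : Matrix (Fin n) (Fin n) ℝ :=
  ∑' τ : ℕ, (A + B * K₀) ^ τ * W * ((A + B * K₀) ^ τ)ᵀ

/-- The constant `c = (1 - ρ^{1/4})² / (16 ‖W̃‖ ‖P‖ ‖P⁻¹‖)`. -/
def rateConst {n m : ℕ} (A : Matrix (Fin n) (Fin n) ℝ) (B : Matrix (Fin n) (Fin m) ℝ)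
    (K₀ : Matrix (Fin m) (Fin n) ℝ) (W : Matrix (Fin n) (Fin n) ℝ)
    (ρ : ℝ) (P : Matrix (Fin n) (Fin n) ℝ) : ℝ :=
  (1 - ρ ^ (1 / 4 : ℝ)) ^ 2 /
    (16 * opNorm (stationaryCov A B K₀ W) * opNorm P * opNorm P⁻¹)

/-- The quantity `t^{1/4} exp (-c M²)` as a function of the pair `(M, t)`. -/
def gapRate (c : ℝ) (p : ℝ × ℕ) : ℝ :=
  (p.2 : ℝ) ^ (1 / 4 : ℝ) * Real.exp (-c * p.1 ^ 2)

/-- The regime `M → ∞`, `t → ∞`, `t^{1/4} exp (-c M²) → 0` for the pair `(M, t)`: a property holds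
eventually in it iff there are `M₀`, `t₀` and `ε > 0` such that it holds at every `(M, t)` with
`M ≥ M₀`, `t ≥ t₀` and `t^{1/4} exp (-c M²) < ε`. -/
def regime (c : ℝ) : Filter (ℝ × ℕ) :=
  (atTop ×ˢ atTop) ⊓ comap (gapRate c) (𝓝 0)

end SwitchedLQR

end

open SwitchedLQR

/-!
The switched controller is compared with the primary controller `u = K₁ x` along the same noise.

Write `V x = xᵀ P x`, `r = ρ^{1/4}`, let `η` be the response of the fallback loop `A + B K₀` to the
noise, and call a time at which the counter vanishes a decision time.

* *Tails at decision times.* With `θ = (1 - r)² / (4 ‖W̃‖ ‖P‖)`, Young's inequality and convexity of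
  `exp` give `exp (θ V (A₁ x + w)) ≤ r exp (θ V x) + exp (‖w‖² / (4 ‖W̃‖))` for one step of the
  primary loop `A₁ = A + B K₁`. For a full fallback period there is an analogous bound, with an
  arbitrarily small factor in front of `exp (θ V x)` once `t` is large, because after a trigger
  `x - η` follows the noise-free fallback loop and `A + B K₀` is stable (`decisionWeight_succ_le`).
  The noise terms have bounded means: `w` and `η` are sub-Gaussian with variance proxy `‖W̃‖`
  (`meanLE_exp_noise`, `meanLE_exp_linearTraj`). So the mean of `exp (θ V x)` over decision times is
  bounded uniformly in time, `M` and `t` (`meanLE_decisionWeight`). As `θ V x ≥ 4 c ‖x‖²`, a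
  fallback period is triggered at a given time with probability `O(exp (-4 c M²))`, and is in
  progress at a given time with probability `O(t exp (-4 c M²))`.
* *Excess input.* The switched input is `K₁ x + s` where `s` vanishes outside fallback periods.
  A square root of the probability of such a period is lost by Young's inequality, so that
  `𝔼 ‖s‖² = O(t^{1/2} exp (-2 c M²))` (`meanLE_sq_norm_excessInput`). Independence of the noise
  of the current fallback period from its trigger is not needed, since the noise enters only through
  the process `η`, which does not depend on the switching.
* *Costs.* The difference of the two trajectories is driven through the stable primary loop by
  `B s`, hence has mean square `O(h²)` with `h = t^{1/4} exp (-c M²)`; stage costs are quadratic, so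
  they differ by `O(h)` in the mean, uniformly in time, and so do the long-run averages
  (`lqCost_sub_le`).
-/

namespace SwitchedLQR

/-! ### Quadratic forms -/

section Quadratic

variable {p : ℕ}

lemma quad_eq_inner (Q : Matrix (Fin p) (Fin p) ℝ) (x : EuclideanSpace ℝ (Fin p)) :
    quad Q x = inner ℝ x (Matrix.toEuclideanCLM (n := Fin p) (𝕜 := ℝ) Q x) := by
  rw [Matrix.inner_toEuclideanCLM]; rfl

lemma act_eq (Q : Matrix (Fin p) (Fin p) ℝ) (x : EuclideanSpace ℝ (Fin p)) :
    act Q x = Matrix.toEuclideanCLM (n := Fin p) (𝕜 := ℝ) Q x := rfl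

lemma continuous_quad (Q : Matrix (Fin p) (Fin p) ℝ) : Continuous (quad Q) := by
  simp only [funext (quad_eq_inner Q)]
  fun_prop

lemma quad_nonneg {Q : Matrix (Fin p) (Fin p) ℝ} (hQ : Q.PosSemidef)
    (x : EuclideanSpace ℝ (Fin p)) : 0 ≤ quad Q x := by
  simpa [quad] using hQ.dotProduct_mulVec_nonneg x.ofLp

lemma opNorm_nonneg (Q : Matrix (Fin p) (Fin p) ℝ) : 0 ≤ opNorm Q := norm_nonneg _

lemma quad_le (Q : Matrix (Fin p) (Fin p) ℝ) (x : EuclideanSpace ℝ (Fin p)) :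
    quad Q x ≤ opNorm Q * ‖x‖ ^ 2 := by
  rw [quad_eq_inner]
  calc _ ≤ ‖x‖ * ‖Matrix.toEuclideanCLM (n := Fin p) (𝕜 := ℝ) Q x‖ := real_inner_le_norm _ _
    _ ≤ ‖x‖ * (opNorm Q * ‖x‖) := by gcongr; exact ContinuousLinearMap.le_opNorm _ _
    _ = _ := by ring

lemma inner_symm_of_posSemidef {Q : Matrix (Fin p) (Fin p) ℝ} (hQ : Q.PosSemidef)
    (x y : EuclideanSpace ℝ (Fin p)) :
    inner ℝ x (Matrix.toEuclideanCLM (n := Fin p) (𝕜 := ℝ) Q y) =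
      inner ℝ y (Matrix.toEuclideanCLM (n := Fin p) (𝕜 := ℝ) Q x) := by
  have h : Qᵀ = Q := by simpa using hQ.isHermitian.eq
  rw [Matrix.inner_toEuclideanCLM, Matrix.inner_toEuclideanCLM, Matrix.dotProduct_mulVec,
    ← Matrix.mulVec_transpose, h, dotProduct_comm]

/-- Young's inequality for the seminorm `√(xᵀ Q x)`. -/
lemma quad_add_le {Q : Matrix (Fin p) (Fin p) ℝ} (hQ : Q.PosSemidef) {r : ℝ} (h0 : 0 < r)
    (h1 : r < 1) (a b : EuclideanSpace ℝ (Fin p)) :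
    quad Q (a + b) ≤ quad Q a / r + quad Q b / (1 - r) := by
  have h := quad_nonneg hQ ((1 - r) • a - r • b)
  have hs := inner_symm_of_posSemidef hQ a b
  simp only [quad_eq_inner, map_add, map_sub, map_smul, inner_add_left, inner_add_right,
    inner_sub_left, inner_sub_right, real_inner_smul_left, real_inner_smul_right] at h ⊢
  have h1' : 0 < 1 - r := by linarith
  rw [div_add_div _ _ h0.ne' h1'.ne', le_div_iff₀ (by positivity)]
  rw [hs] at h ⊢
  nlinarith

lemma sq_norm_le_quad {P : Matrix (Fin p) (Fin p) ℝ} (hP : P.PosDef)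
    (x : EuclideanSpace ℝ (Fin p)) : ‖x‖ ^ 2 ≤ opNorm P⁻¹ * quad P x := by
  set y := Matrix.toEuclideanCLM (n := Fin p) (𝕜 := ℝ) P⁻¹ x with hy
  have hPy : Matrix.toEuclideanCLM (n := Fin p) (𝕜 := ℝ) P y = x := by
    have : P * P⁻¹ = 1 := Matrix.mul_nonsing_inv P ((Matrix.isUnit_iff_isUnit_det _).1 hP.isUnit)
    rw [hy, ← mul_apply_eq_comp, ← map_mul, this]; simp
  set c := opNorm P⁻¹ with hc
  have hyx : inner ℝ x y ≤ c * ‖x‖ ^ 2 := by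
    have := quad_le P⁻¹ x
    rwa [quad_eq_inner] at this
  have hc0 : 0 ≤ c := opNorm_nonneg _
  -- Expand `0 ≤ V (c x - y)` with `y = P⁻¹ x`.
  have h := quad_nonneg hP.posSemidef (c • x - y)
  have hs := inner_symm_of_posSemidef hP.posSemidef y x
  simp only [quad_eq_inner, map_sub, map_smul,
    inner_sub_left, inner_sub_right, real_inner_smul_left, real_inner_smul_right] at h ⊢
  rw [hs, hPy, real_inner_self_eq_norm_sq, real_inner_comm x y] at h
  rcases hc0.eq_or_lt with h0 | h0
  · have : x = 0 := by
      have hz : Matrix.toEuclideanCLM (n := Fin p) (𝕜 := ℝ) P⁻¹ = 0 := norm_eq_zero.1 h0.symm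
      have : y = 0 := by rw [hy, hz]; rfl
      rw [← hPy, this, map_zero]
    simp [this]
  · refine le_of_mul_le_mul_left ?_ h0
    linarith

lemma opNorm_pos [NeZero p] {Q : Matrix (Fin p) (Fin p) ℝ} (hQ : Q.PosDef) : 0 < opNorm Q := by
  refine (opNorm_nonneg Q).lt_of_ne' fun h => ?_
  have hz : Matrix.toEuclideanCLM (n := Fin p) (𝕜 := ℝ) Q = 0 := norm_eq_zero.1 h
  have : Q = 0 := (map_eq_zero_iff _ (EquivLike.injective _)).1 hz
  have h2 := hQ.isUnit
  rw [this] at h2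
  exact not_isUnit_zero h2

/-- A quadratic form moves by at most `O(h)` when its argument moves by `O(h)` in mean square. -/
lemma abs_quad_add_sub_le (Q : Matrix (Fin p) (Fin p) ℝ) (y d : EuclideanSpace ℝ (Fin p))
    {h : ℝ} (hh : 0 < h) (hh1 : h ≤ 1) :
    |quad Q (y + d) - quad Q y| ≤ opNorm Q * (2 / h * ‖d‖ ^ 2 + h * ‖y‖ ^ 2) := by
  have key : ∀ a b : EuclideanSpace ℝ (Fin p),
      |inner ℝ a (Matrix.toEuclideanCLM (n := Fin p) (𝕜 := ℝ) Q b)| ≤ opNorm Q * (‖a‖ * ‖b‖) := by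
    intro a b
    calc _ ≤ ‖a‖ * ‖Matrix.toEuclideanCLM (n := Fin p) (𝕜 := ℝ) Q b‖ := abs_real_inner_le_norm _ _
      _ ≤ ‖a‖ * (opNorm Q * ‖b‖) := by gcongr; exact ContinuousLinearMap.le_opNorm _ _
      _ = _ := by ring
  have e : quad Q (y + d) - quad Q y =
      inner ℝ y (Matrix.toEuclideanCLM (n := Fin p) (𝕜 := ℝ) Q d) +
      inner ℝ d (Matrix.toEuclideanCLM (n := Fin p) (𝕜 := ℝ) Q y) +
      inner ℝ d (Matrix.toEuclideanCLM (n := Fin p) (𝕜 := ℝ) Q d) := by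
    simp only [quad_eq_inner, map_add, inner_add_left, inner_add_right]; ring
  rw [e]
  have h1 := key y d
  have h2 := key d y
  have h3 := key d d
  have h4 : ‖y‖ * ‖d‖ * 2 + ‖d‖ * ‖d‖ ≤ 2 / h * ‖d‖ ^ 2 + h * ‖y‖ ^ 2 := by
    have : 2 / h * ‖d‖ ^ 2 + h * ‖y‖ ^ 2 - (‖y‖ * ‖d‖ * 2 + ‖d‖ * ‖d‖) =
        (‖d‖ - h * ‖y‖) ^ 2 / h + (1 - h) / h * ‖d‖ ^ 2 := by field_simp; ring
    have : 0 ≤ (‖d‖ - h * ‖y‖) ^ 2 / h + (1 - h) / h * ‖d‖ ^ 2 := by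
      have : 0 ≤ 1 - h := by linarith
      positivity
    linarith
  calc _ ≤ _ := (abs_add_le _ _).trans (add_le_add_left (abs_add_le _ _) _)
    _ ≤ opNorm Q * (‖y‖ * ‖d‖ * 2 + ‖d‖ * ‖d‖) := by linarith
    _ ≤ _ := by gcongr; exact opNorm_nonneg Q

end Quadratic

/-! ### Closed loops -/

section ClosedLoop

variable {n m : ℕ}

/-- The closed-loop map `x ↦ (A + B K) x`. -/
noncomputable def closedLoop (A : Matrix (Fin n) (Fin n) ℝ) (B : Matrix (Fin n) (Fin m) ℝ)
    (K : Matrix (Fin m) (Fin n) ℝ) : EuclideanSpace ℝ (Fin n) →L[ℝ] EuclideanSpace ℝ (Fin n) :=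
  Matrix.toEuclideanCLM (n := Fin n) (𝕜 := ℝ) (A + B * K)

lemma act_mul {p q s : ℕ} (A : Matrix (Fin p) (Fin q) ℝ) (B : Matrix (Fin q) (Fin s) ℝ)
    (x : EuclideanSpace ℝ (Fin s)) : act (A * B) x = act A (act B x) := by
  simp [act, Matrix.toLpLin_apply, Matrix.mulVec_mulVec]

lemma closedLoop_apply (A : Matrix (Fin n) (Fin n) ℝ) (B : Matrix (Fin n) (Fin m) ℝ)
    (K : Matrix (Fin m) (Fin n) ℝ) (x : EuclideanSpace ℝ (Fin n)) :
    act A x + act B (act K x) = closedLoop A B K x := by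
  rw [closedLoop, ← act_eq, ← act_mul]
  simp [act, map_add]

lemma quad_transpose_mul_mul (P M : Matrix (Fin n) (Fin n) ℝ) (x : EuclideanSpace ℝ (Fin n)) :
    quad (Mᵀ * P * M) x = quad P (Matrix.toEuclideanCLM (n := Fin n) (𝕜 := ℝ) M x) := by
  simp [quad, ← Matrix.mulVec_mulVec, Matrix.dotProduct_mulVec _ Mᵀ, Matrix.vecMul_transpose]

lemma quad_closedLoop_le {A : Matrix (Fin n) (Fin n) ℝ} {B : Matrix (Fin n) (Fin m) ℝ}
    {K : Matrix (Fin m) (Fin n) ℝ} {P : Matrix (Fin n) (Fin n) ℝ} {ρ : ℝ}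
    (hLyap : (ρ • P - (A + B * K)ᵀ * P * (A + B * K)).PosDef) (x : EuclideanSpace ℝ (Fin n)) :
    quad P (closedLoop A B K x) ≤ ρ * quad P x := by
  have h := quad_nonneg hLyap.posSemidef x
  have e : quad (ρ • P - (A + B * K)ᵀ * P * (A + B * K)) x =
      ρ * quad P x - quad ((A + B * K)ᵀ * P * (A + B * K)) x := by
    simp [quad, Matrix.sub_mulVec, dotProduct_sub, Matrix.smul_mulVec]
  rw [e, quad_transpose_mul_mul] at h
  exact sub_nonneg.1 h

open scoped Matrix.Norms.L2Operator in
lemma norm_le_norm_map_complex (M : Matrix (Fin n) (Fin n) ℝ) :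
    ‖M‖ ≤ ‖M.map (algebraMap ℝ ℂ)‖ := by
  rw [Matrix.cstar_norm_def]
  refine ContinuousLinearMap.opNorm_le_bound _ (norm_nonneg _) fun x => ?_
  let z : EuclideanSpace ℂ (Fin n) := WithLp.toLp 2 fun i => (x i : ℂ)
  have hz : ‖z‖ = ‖x‖ := by simp [z, EuclideanSpace.norm_eq]
  have h := Matrix.l2_opNorm_mulVec (M.map (algebraMap ℝ ℂ)) z
  rw [hz] at h
  refine le_trans (le_of_eq ?_) h
  rw [EuclideanSpace.norm_eq, EuclideanSpace.norm_eq]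
  congr 1
  refine Finset.sum_congr rfl fun i _ => ?_
  congr 1
  rw [← Complex.norm_real]
  congr 1
  simp [z, Matrix.mulVec, dotProduct]

open scoped Matrix.Norms.L2Operator in
/-- Gelfand's formula: powers of a matrix whose complex spectral radius is less than one decay
geometrically. -/
lemma exists_norm_pow_le {M : Matrix (Fin n) (Fin n) ℝ}
    (hM : spectralRadius ℂ (M.map (algebraMap ℝ ℂ)) < 1) :
    ∃ C q : ℝ, 0 ≤ C ∧ 0 < q ∧ q < 1 ∧ ∀ k : ℕ, ‖M ^ k‖ ≤ C * q ^ k := by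
  set a := M.map (algebraMap ℝ ℂ) with ha
  obtain ⟨q, hq, hq1⟩ := ENNReal.lt_iff_exists_nnreal_btwn.1 hM
  have hq0 : 0 < q := by exact_mod_cast lt_of_le_of_lt zero_le hq
  have hev : ∀ᶠ k : ℕ in atTop, ‖a ^ k‖ / (q : ℝ) ^ k ≤ 1 := by
    filter_upwards [(spectrum.pow_nnnorm_pow_one_div_tendsto_nhds_spectralRadius a).eventually
      (gt_mem_nhds hq), eventually_gt_atTop 0] with k hk hk0
    have h2 := ENNReal.rpow_le_rpow hk.le (Nat.cast_nonneg' k : (0 : ℝ) ≤ k)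
    rw [← ENNReal.rpow_mul, one_div, inv_mul_cancel₀ (by positivity), ENNReal.rpow_one,
      ENNReal.rpow_natCast] at h2
    rw [div_le_one (by positivity)]
    exact_mod_cast h2
  obtain ⟨C, hC⟩ := (isBoundedUnder_of_eventually_le hev).bddAbove_range
  refine ⟨C, q, ?_, by exact_mod_cast hq0, by exact_mod_cast hq1, fun k => ?_⟩
  · exact le_trans (by positivity) (hC ⟨0, rfl⟩)
  · have h1 := hC ⟨k, rfl⟩
    have h2 : (0 : ℝ) < (q : ℝ) ^ k := by positivity
    rw [div_le_iff₀ h2] at h1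
    refine le_trans (norm_le_norm_map_complex _) (le_trans (le_of_eq ?_) h1)
    rw [ha]
    exact congrArg norm (map_pow (algebraMap ℝ ℂ).mapMatrix M k)

lemma exists_norm_closedLoop_pow_le {A : Matrix (Fin n) (Fin n) ℝ} {B : Matrix (Fin n) (Fin m) ℝ}
    {K : Matrix (Fin m) (Fin n) ℝ} (hK : IsStabilizing A B K) :
    ∃ C q : ℝ, 0 ≤ C ∧ 0 < q ∧ q < 1 ∧ ∀ k : ℕ, ‖closedLoop A B K ^ k‖ ≤ C * q ^ k := by
  obtain ⟨C, q, h0, h1, h2, h⟩ := exists_norm_pow_le hK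
  refine ⟨C, q, h0, h1, h2, fun k => ?_⟩
  rw [closedLoop, ← map_pow]
  exact h k

lemma quad_mul_mul_transpose (W M : Matrix (Fin n) (Fin n) ℝ) (x : EuclideanSpace ℝ (Fin n)) :
    quad (M * W * Mᵀ) x = quad W (Matrix.toEuclideanCLM (n := Fin n) (𝕜 := ℝ) Mᵀ x) := by
  rw [← quad_transpose_mul_mul, Matrix.transpose_transpose]

open scoped Matrix.Norms.L2Operator in
/-- Stability of the loop makes the series defining `W̃` converge, and as its terms are positive
semidefinite, `‖W̃‖` controls every partial sum. -/
lemma sum_quad_le_stationaryCov {A : Matrix (Fin n) (Fin n) ℝ} {B : Matrix (Fin n) (Fin m) ℝ}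
    {K₀ : Matrix (Fin m) (Fin n) ℝ} {W : Matrix (Fin n) (Fin n) ℝ} (hW : W.PosSemidef)
    (hK₀ : IsStabilizing A B K₀) (k : ℕ) (v : EuclideanSpace ℝ (Fin n)) :
    ∑ τ ∈ Finset.range k,
        quad W (Matrix.toEuclideanCLM (n := Fin n) (𝕜 := ℝ) ((A + B * K₀) ^ τ)ᵀ v) ≤
      opNorm (stationaryCov A B K₀ W) * ‖v‖ ^ 2 := by
  obtain ⟨C, q, hC, hq0, hq1, hpow⟩ := exists_norm_pow_le hK₀
  have hsum : Summable fun τ : ℕ => (A + B * K₀) ^ τ * W * ((A + B * K₀) ^ τ)ᵀ := by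
    refine Summable.of_norm_bounded (g := fun τ => C * ‖W‖ * C * (q ^ 2) ^ τ)
      ((summable_geometric_of_lt_one (by positivity) (by nlinarith)).mul_left _) fun τ => ?_
    have ht : ‖((A + B * K₀) ^ τ)ᵀ‖ = ‖(A + B * K₀) ^ τ‖ := by
      rw [← Matrix.conjTranspose_eq_transpose_of_trivial, Matrix.l2_opNorm_conjTranspose]
    calc _ ≤ ‖(A + B * K₀) ^ τ‖ * ‖W‖ * ‖(A + B * K₀) ^ τ‖ := by
          refine (norm_mul_le _ _).trans ?_
          rw [ht]; gcongr; exact norm_mul_le _ _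
      _ ≤ (C * q ^ τ) * ‖W‖ * (C * q ^ τ) := by gcongr <;> exact hpow τ
      _ = _ := by ring
  let f : Matrix (Fin n) (Fin n) ℝ →+ ℝ :=
    { toFun := fun Q => quad Q v
      map_zero' := by simp [quad]
      map_add' := fun _ _ => by simp [quad, Matrix.add_mulVec, dotProduct_add] }
  have hf : Continuous f := by
    change Continuous fun Q : Matrix (Fin n) (Fin n) ℝ => v.ofLp ⬝ᵥ (Q *ᵥ v.ofLp)
    fun_prop
  have h := hsum.hasSum.map f hf
  refine le_trans ?_ (quad_le _ v)
  simp_rw [← quad_mul_mul_transpose]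
  exact sum_le_hasSum _ (fun τ _ => by
    change 0 ≤ quad _ v
    rw [quad_mul_mul_transpose]; exact quad_nonneg hW _) h

end ClosedLoop

/-! ### Bounded means -/

section MeanLE

variable {Ω : Type*} [MeasurableSpace Ω] {μ : Measure Ω}

/-- The random variable `f` is integrable with mean at most `K`. -/
def MeanLE (μ : Measure Ω) (f : Ω → ℝ) (K : ℝ) : Prop :=
  Integrable f μ ∧ ∫ ω, f ω ∂μ ≤ K

lemma MeanLE.add {f g : Ω → ℝ} {K L : ℝ} (hf : MeanLE μ f K) (hg : MeanLE μ g L) :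
    MeanLE μ (fun ω => f ω + g ω) (K + L) :=
  ⟨hf.1.add hg.1, by rw [integral_add hf.1 hg.1]; exact add_le_add hf.2 hg.2⟩

lemma MeanLE.const_mul {f : Ω → ℝ} {K : ℝ} (hf : MeanLE μ f K) {a : ℝ} (ha : 0 ≤ a) :
    MeanLE μ (fun ω => a * f ω) (a * K) :=
  ⟨hf.1.const_mul a, by rw [integral_const_mul]; exact mul_le_mul_of_nonneg_left hf.2 ha⟩

lemma MeanLE.sum {ι : Type*} {s : Finset ι} {f : ι → Ω → ℝ} {K : ι → ℝ}
    (hf : ∀ i ∈ s, MeanLE μ (f i) (K i)) :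
    MeanLE μ (fun ω => ∑ i ∈ s, f i ω) (∑ i ∈ s, K i) :=
  ⟨integrable_finsetSum _ fun i hi => (hf i hi).1, by
    rw [integral_finsetSum _ fun i hi => (hf i hi).1]
    exact Finset.sum_le_sum fun i hi => (hf i hi).2⟩

lemma MeanLE.trans {f : Ω → ℝ} {K L : ℝ} (hf : MeanLE μ f K) (h : K ≤ L) : MeanLE μ f L :=
  ⟨hf.1, hf.2.trans h⟩

lemma meanLE_const [IsProbabilityMeasure μ] (a : ℝ) : MeanLE μ (fun _ => a) a :=
  ⟨integrable_const a, by simp⟩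

lemma MeanLE.mono {f g : Ω → ℝ} {K : ℝ} (hg : MeanLE μ g K) (hf : AEMeasurable f μ)
    (h0 : ∀ ω, 0 ≤ f ω) (h : ∀ ω, f ω ≤ g ω) : MeanLE μ f K := by
  have hi : Integrable f μ := hg.1.mono' hf.aestronglyMeasurable
    (Eventually.of_forall fun ω => by rw [Real.norm_of_nonneg (h0 ω)]; exact h ω)
  exact ⟨hi, (integral_mono hi hg.1 h).trans hg.2⟩

lemma meanLE_of_lintegral_le {f : Ω → ℝ} {K : ℝ} (hK : 0 ≤ K) (hf : AEMeasurable f μ)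
    (h0 : ∀ ω, 0 ≤ f ω) (h : ∫⁻ ω, ENNReal.ofReal (f ω) ∂μ ≤ ENNReal.ofReal K) :
    MeanLE μ f K := by
  refine ⟨⟨hf.aestronglyMeasurable, ?_⟩, ?_⟩
  · rw [hasFiniteIntegral_iff_ofReal (Eventually.of_forall h0)]
    exact h.trans_lt ENNReal.ofReal_lt_top
  · rw [integral_eq_lintegral_of_nonneg_ae (Eventually.of_forall h0) hf.aestronglyMeasurable]
    exact ENNReal.toReal_le_of_le_ofReal hK h

end MeanLE

/-! ### Gaussian exponential moments -/

section Gaussian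

variable {n : ℕ} {Ω : Type*} [MeasurableSpace Ω] {μ : Measure Ω}

lemma integrable_exp_sq_div_four_gaussianReal :
    Integrable (fun x : ℝ => Real.exp (x ^ 2 / 4)) (gaussianReal 0 1) := by
  rw [gaussianReal_of_var_ne_zero _ one_ne_zero,
    integrable_withDensity_iff_integrable_smul' (measurable_gaussianPDF _ _)
      (Eventually.of_forall fun x => gaussianPDF_lt_top)]
  refine ((integrable_exp_neg_mul_sq (b := 1 / 4) (by norm_num)).const_mul
    ((√(2 * Real.pi * 1))⁻¹)).congr (Eventually.of_forall fun x => ?_)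
  simp only [toReal_gaussianPDF, gaussianPDFReal, smul_eq_mul, NNReal.coe_one]
  rw [mul_assoc _ (Real.exp _), ← Real.exp_add]
  ring_nf

lemma integrable_exp_sq_norm_div_four_stdGaussian :
    Integrable (fun x => Real.exp (‖x‖ ^ 2 / 4)) (stdGaussian (EuclideanSpace ℝ (Fin n))) := by
  rw [← map_pi_eq_stdGaussian, integrable_map_measure (by fun_prop) (by fun_prop)]
  refine (Integrable.fintype_prod (μ := fun _ : Fin n => gaussianReal 0 1)
    fun _ => integrable_exp_sq_div_four_gaussianReal).congr (Eventually.of_forall fun x => ?_)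
  simp [EuclideanSpace.norm_sq_eq, ← Real.exp_sum, Finset.sum_div]

/-- The constant `𝔼 exp (‖G‖² / 4)` for a standard Gaussian vector `G`. -/
noncomputable def gaussConst (n : ℕ) : ℝ :=
  ∫ x, Real.exp (‖x‖ ^ 2 / 4) ∂(stdGaussian (EuclideanSpace ℝ (Fin n)))

lemma gaussConst_nonneg (n : ℕ) : 0 ≤ gaussConst n :=
  integral_nonneg fun _ => (Real.exp_pos _).le

lemma mgf_inner_of_hasLaw {X : Ω → EuclideanSpace ℝ (Fin n)} {W : Matrix (Fin n) (Fin n) ℝ}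
    (hW : W.PosSemidef) (hX : HasLaw X (multivariateGaussian 0 W) μ)
    (v : EuclideanSpace ℝ (Fin n)) :
    mgf (fun ω => inner ℝ v (X ω)) μ 1 = Real.exp (quad W v / 2) := by
  have hmap : μ.map (fun ω => inner ℝ v (X ω)) = gaussianReal 0 (quad W v).toNNReal := by
    have h1 := IsGaussian.map_eq_gaussianReal (μ := multivariateGaussian 0 W) (innerSL ℝ v)
    rw [← hX.map_eq, AEMeasurable.map_map_of_aemeasurable (by fun_prop) hX.aemeasurable,
      hX.map_eq] at h1
    have h2 : (multivariateGaussian 0 W)[innerSL ℝ v] = 0 := by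
      rw [(innerSL ℝ v).integral_comp_id_comm IsGaussian.integrable_id,
        integral_id_multivariateGaussian, map_zero]
    have h3 : Var[innerSL ℝ v; multivariateGaussian 0 W] = quad W v := by
      have := covarianceBilin_multivariateGaussian (μ := (0 : EuclideanSpace ℝ (Fin n))) hW v v
      rw [covarianceBilin_self IsGaussian.memLp_two_id] at this
      exact this
    rw [h2, h3] at h1
    exact h1
  rw [mgf_gaussianReal hmap, Real.coe_toNNReal _ (quad_nonneg hW v)]
  ring_nf

lemma lintegral_exp_of_mgf_eq {Y : Ω → ℝ} {c : ℝ} (h : mgf Y μ 1 = Real.exp c) :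
    ∫⁻ ω, ENNReal.ofReal (Real.exp (Y ω)) ∂μ = ENNReal.ofReal (Real.exp c) := by
  have h' : ∫ ω, Real.exp (Y ω) ∂μ = Real.exp c := by simpa [mgf] using h
  have hi : Integrable (fun ω => Real.exp (Y ω)) μ := by
    by_contra hn
    rw [integral_undef hn] at h'
    exact (Real.exp_pos c).ne h'
  rw [← h', ofReal_integral_eq_lintegral_ofReal hi (Eventually.of_forall fun _ =>
    (Real.exp_pos _).le)]

lemma lintegral_exp_inner_stdGaussian (v : EuclideanSpace ℝ (Fin n)) :
    ∫⁻ g, ENNReal.ofReal (Real.exp (inner ℝ v g)) ∂(stdGaussian (EuclideanSpace ℝ (Fin n))) =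
      ENNReal.ofReal (Real.exp (‖v‖ ^ 2 / 2)) := by
  refine lintegral_exp_of_mgf_eq ?_
  have := mgf_inner_of_hasLaw (W := 1) (μ := stdGaussian (EuclideanSpace ℝ (Fin n)))
    Matrix.PosSemidef.one (X := id) ⟨aemeasurable_id, by
      rw [multivariateGaussian_zero_one, Measure.map_id]⟩ v
  have e : quad (1 : Matrix (Fin n) (Fin n) ℝ) v = ‖v‖ ^ 2 := by
    rw [quad_eq_inner, map_one]; exact real_inner_self_eq_norm_sq v
  rwa [e] at this

/-- A sub-Gaussian vector has the square-exponential moment of a Gaussian vector. The square in the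
exponent is linearized by an independent standard Gaussian vector `G`:
`exp (‖x‖² / (4 σ)) = 𝔼 exp (⟪x, G⟫ / √(2 σ))`. -/
lemma meanLE_exp_sq_norm_of_subgaussian [SFinite μ] {X : Ω → EuclideanSpace ℝ (Fin n)}
    (hX : AEMeasurable X μ) {σ : ℝ} (hσ : 0 < σ)
    (h : ∀ v, ∫⁻ ω, ENNReal.ofReal (Real.exp (inner ℝ v (X ω))) ∂μ ≤
      ENNReal.ofReal (Real.exp (σ * ‖v‖ ^ 2 / 2))) :
    MeanLE μ (fun ω => Real.exp (‖X ω‖ ^ 2 / (4 * σ))) (gaussConst n) := by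
  refine meanLE_of_lintegral_le (gaussConst_nonneg n) (by fun_prop)
    (fun _ => (Real.exp_pos _).le) ?_
  set a : ℝ := (√(2 * σ))⁻¹ with ha
  have ha2 : a ^ 2 = 1 / (2 * σ) := by
    rw [ha, inv_pow, Real.sq_sqrt (by positivity), one_div]
  have hlin : ∀ x : EuclideanSpace ℝ (Fin n), ENNReal.ofReal (Real.exp (‖x‖ ^ 2 / (4 * σ))) =
      ∫⁻ g, ENNReal.ofReal (Real.exp (inner ℝ (a • g) x))
        ∂(stdGaussian (EuclideanSpace ℝ (Fin n))) := by
    intro x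
    have e : ‖x‖ ^ 2 / (4 * σ) = ‖a • x‖ ^ 2 / 2 := by
      rw [norm_smul, mul_pow, Real.norm_eq_abs, sq_abs, ha2]; field_simp; ring
    rw [e, ← lintegral_exp_inner_stdGaussian]
    simp only [real_inner_smul_left, real_inner_comm x, real_inner_smul_right]
  simp_rw [hlin]
  rw [lintegral_lintegral_swap]
  · rw [gaussConst, ofReal_integral_eq_lintegral_ofReal
      integrable_exp_sq_norm_div_four_stdGaussian (Eventually.of_forall fun _ =>
        (Real.exp_pos _).le)]
    refine lintegral_mono fun g => (h (a • g)).trans (le_of_eq ?_)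
    congr 2
    rw [norm_smul, mul_pow, Real.norm_eq_abs, sq_abs, ha2]; field_simp; ring
  · have : AEMeasurable (fun p : Ω × EuclideanSpace ℝ (Fin n) => X p.1)
        (μ.prod (stdGaussian (EuclideanSpace ℝ (Fin n)))) := hX.comp_fst
    simp only [Function.uncurry_def]
    fun_prop

end Gaussian

section Noise

variable {n m : ℕ} {Ω : Type*} [MeasurableSpace Ω] {μ : Measure Ω}
  {A : Matrix (Fin n) (Fin n) ℝ} {B : Matrix (Fin n) (Fin m) ℝ} {K : Matrix (Fin m) (Fin n) ℝ}
  {W : Matrix (Fin n) (Fin n) ℝ} {w : ℕ → Ω → EuclideanSpace ℝ (Fin n)}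

lemma linearTraj_succ (v : ℕ → EuclideanSpace ℝ (Fin n)) (k : ℕ) :
    linearTraj A B K v (k + 1) = closedLoop A B K (linearTraj A B K v k) + v k := by
  rw [linearTraj, closedLoop_apply]

lemma linearTraj_eq_sum (v : ℕ → EuclideanSpace ℝ (Fin n)) (k : ℕ) :
    linearTraj A B K v k = ∑ τ ∈ Finset.range k, (closedLoop A B K ^ (k - 1 - τ)) (v τ) := by
  induction k with
  | zero => simp [linearTraj]
  | succ k ih =>
    rw [linearTraj_succ, ih, Finset.sum_range_succ, map_sum]
    congr 1
    · refine Finset.sum_congr rfl fun τ hτ => ?_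
      have : k + 1 - 1 - τ = (k - 1 - τ) + 1 := by have := Finset.mem_range.1 hτ; omega
      rw [this, pow_succ']
      rfl
    · simp

lemma inner_toEuclideanCLM_eq (M : Matrix (Fin n) (Fin n) ℝ) (v x : EuclideanSpace ℝ (Fin n)) :
    inner ℝ v (Matrix.toEuclideanCLM (n := Fin n) (𝕜 := ℝ) M x) =
      inner ℝ (Matrix.toEuclideanCLM (n := Fin n) (𝕜 := ℝ) Mᵀ v) x := by
  rw [real_inner_comm x, Matrix.inner_toEuclideanCLM, Matrix.inner_toEuclideanCLM,
    Matrix.dotProduct_mulVec, dotProduct_comm, Matrix.mulVec_transpose]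

lemma aemeasurable_linearTraj (hw : ∀ k, AEMeasurable (w k) μ) (k : ℕ) :
    AEMeasurable (fun ω => linearTraj A B K (fun j => w j ω) k) μ := by
  simp_rw [linearTraj_eq_sum]
  refine Finset.aemeasurable_fun_sum _ fun τ _ => ?_
  exact (ContinuousLinearMap.measurable _).comp_aemeasurable (hw τ)

lemma mgf_inner_linearTraj (hW : W.PosSemidef) (hw_indep : iIndepFun w μ)
    (hw_law : ∀ k, HasLaw (w k) (multivariateGaussian 0 W) μ) (k : ℕ)
    (v : EuclideanSpace ℝ (Fin n)) :
    mgf (fun ω => inner ℝ v (linearTraj A B K (fun j => w j ω) k)) μ 1 =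
      Real.exp ((∑ τ ∈ Finset.range k,
        quad W (Matrix.toEuclideanCLM (n := Fin n) (𝕜 := ℝ) ((A + B * K) ^ τ)ᵀ v)) / 2) := by
  let u : ℕ → EuclideanSpace ℝ (Fin n) := fun τ =>
    Matrix.toEuclideanCLM (n := Fin n) (𝕜 := ℝ) ((A + B * K) ^ (k - 1 - τ))ᵀ v
  have e : (fun ω => inner ℝ v (linearTraj A B K (fun j => w j ω) k)) =
      ∑ τ ∈ Finset.range k, fun ω => inner ℝ (u τ) (w τ ω) := by
    ext ω
    rw [linearTraj_eq_sum, inner_sum, Finset.sum_apply]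
    refine Finset.sum_congr rfl fun τ _ => ?_
    rw [closedLoop, ← map_pow, inner_toEuclideanCLM_eq]
  have hind : iIndepFun (fun τ ω => inner ℝ (u τ) (w τ ω)) μ :=
    hw_indep.comp (fun τ x => inner ℝ (u τ) x) fun τ => by fun_prop
  rw [e, hind.mgf_sum₀ fun τ => by have := (hw_law τ).aemeasurable; fun_prop]
  simp_rw [fun τ => mgf_inner_of_hasLaw hW (hw_law τ) (u τ)]
  rw [← Real.exp_sum, Finset.sum_div]
  exact congrArg Real.exp (Finset.sum_range_reflect (fun τ => quad W
    (Matrix.toEuclideanCLM (n := Fin n) (𝕜 := ℝ) ((A + B * K) ^ τ)ᵀ v) / 2) k)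

/-- The noise response of the fallback loop has square-exponential moments at the scale of `‖W̃‖`,
uniformly in time. -/
lemma meanLE_exp_linearTraj [IsProbabilityMeasure μ] (hW : W.PosSemidef)
    (hw_indep : iIndepFun w μ) (hw_law : ∀ k, HasLaw (w k) (multivariateGaussian 0 W) μ)
    (hK : IsStabilizing A B K) (hσ : 0 < opNorm (stationaryCov A B K W)) (k : ℕ) :
    MeanLE μ (fun ω => Real.exp (‖linearTraj A B K (fun j => w j ω) k‖ ^ 2 /
      (4 * opNorm (stationaryCov A B K W)))) (gaussConst n) := by
  refine meanLE_exp_sq_norm_of_subgaussian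
    (aemeasurable_linearTraj (fun k => (hw_law k).aemeasurable) k) hσ fun v => ?_
  rw [lintegral_exp_of_mgf_eq (mgf_inner_linearTraj hW hw_indep hw_law k v)]
  gcongr
  exact sum_quad_le_stationaryCov hW hK k v

lemma quad_le_stationaryCov (hW : W.PosSemidef) (hK : IsStabilizing A B K)
    (v : EuclideanSpace ℝ (Fin n)) : quad W v ≤ opNorm (stationaryCov A B K W) * ‖v‖ ^ 2 := by
  simpa using sum_quad_le_stationaryCov hW hK 1 v

lemma opNorm_stationaryCov_pos [NeZero n] (hW : W.PosDef) (hK : IsStabilizing A B K) :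
    0 < opNorm (stationaryCov A B K W) := by
  refine (opNorm_nonneg _).lt_of_ne' fun h => ?_
  obtain ⟨v, hv⟩ := exists_ne (0 : EuclideanSpace ℝ (Fin n))
  have h1 := quad_le_stationaryCov hW.posSemidef hK v
  have h2 := sq_norm_le_quad hW v
  have h3 : 0 < ‖v‖ ^ 2 := by positivity
  rw [h, zero_mul] at h1
  have := mul_nonpos_of_nonneg_of_nonpos (opNorm_nonneg W⁻¹) h1
  linarith

lemma meanLE_exp_noise [IsProbabilityMeasure μ] (hW : W.PosSemidef)
    (hw_law : ∀ k, HasLaw (w k) (multivariateGaussian 0 W) μ)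
    (hK : IsStabilizing A B K) (hσ : 0 < opNorm (stationaryCov A B K W)) (k : ℕ) :
    MeanLE μ (fun ω => Real.exp (‖w k ω‖ ^ 2 / (4 * opNorm (stationaryCov A B K W))))
      (gaussConst n) := by
  refine meanLE_exp_sq_norm_of_subgaussian (hw_law k).aemeasurable hσ fun v => ?_
  rw [lintegral_exp_of_mgf_eq (mgf_inner_of_hasLaw hW (hw_law k) v)]
  gcongr
  exact quad_le_stationaryCov hW hK v

end Noise

/-! ### Trajectories of the switched loop -/

section Trajectory

variable {n m : ℕ} {A : Matrix (Fin n) (Fin n) ℝ} {B : Matrix (Fin n) (Fin m) ℝ}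
  {K₀ K₁ : Matrix (Fin m) (Fin n) ℝ} {M : ℝ} {t : ℕ}

/-- The fallback gain is applied at the pair `s` of state and counter. -/
def UsesFallback (M : ℝ) (s : EuclideanSpace ℝ (Fin n) × ℕ) : Prop := 0 < s.2 ∨ M ≤ ‖s.1‖

open scoped Classical in
/-- The excess of the switched input over the input `K₁ x` of the primary controller. -/
noncomputable def excessInput (K₀ K₁ : Matrix (Fin m) (Fin n) ℝ) (M : ℝ)
    (s : EuclideanSpace ℝ (Fin n) × ℕ) : EuclideanSpace ℝ (Fin m) :=
  if UsesFallback M s then act (K₀ - K₁) s.1 else 0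

lemma switchLogic_fst (x : EuclideanSpace ℝ (Fin n)) (ξ : ℕ) :
    (switchLogic K₀ K₁ M t x ξ).1 = act K₁ x + excessInput K₀ K₁ M (x, ξ) := by
  have e : act (K₀ - K₁) x = act K₀ x - act K₁ x := by simp [act, map_sub]
  by_cases h0 : 0 < ξ <;> by_cases hM : M ≤ ‖x‖ <;>
    simp [switchLogic, excessInput, UsesFallback, h0, hM, e]

lemma switchLogic_snd_of_pos (x : EuclideanSpace ℝ (Fin n)) {ξ : ℕ} (h : 0 < ξ) :
    (switchLogic K₀ K₁ M t x ξ).2 = ξ - 1 := by simp [switchLogic, h]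

lemma switchLogic_snd_of_le {x : EuclideanSpace ℝ (Fin n)} (h : M ≤ ‖x‖) :
    (switchLogic K₀ K₁ M t x 0).2 = t - 1 := by simp [switchLogic, h]

lemma switchLogic_snd_of_lt {x : EuclideanSpace ℝ (Fin n)} (h : ‖x‖ < M) :
    (switchLogic K₀ K₁ M t x 0).2 = 0 := by simp [switchLogic, h.not_ge]

lemma switchedTraj_succ_fst (v : ℕ → EuclideanSpace ℝ (Fin n)) (k : ℕ) :
    (switchedTraj A B K₀ K₁ M t v (k + 1)).1 =
      closedLoop A B K₁ (switchedTraj A B K₀ K₁ M t v k).1 +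
        act B (excessInput K₀ K₁ M (switchedTraj A B K₀ K₁ M t v k)) + v k := by
  rw [switchedTraj, ← closedLoop_apply]
  simp only [switchLogic_fst, Prod.mk.eta, map_add]
  abel

lemma switchedTraj_succ_snd (v : ℕ → EuclideanSpace ℝ (Fin n)) (k : ℕ) :
    (switchedTraj A B K₀ K₁ M t v (k + 1)).2 =
      (switchLogic K₀ K₁ M t (switchedTraj A B K₀ K₁ M t v k).1
        (switchedTraj A B K₀ K₁ M t v k).2).2 := rfl

lemma switchedInput_eq (v : ℕ → EuclideanSpace ℝ (Fin n)) (k : ℕ) :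
    switchedInput A B K₀ K₁ M t v k = act K₁ (switchedTraj A B K₀ K₁ M t v k).1 +
      excessInput K₀ K₁ M (switchedTraj A B K₀ K₁ M t v k) := by
  rw [switchedInput, switchLogic_fst]

lemma switchedTraj_succ_fst_of_fallback {v : ℕ → EuclideanSpace ℝ (Fin n)} {k : ℕ}
    (h : UsesFallback M (switchedTraj A B K₀ K₁ M t v k)) :
    (switchedTraj A B K₀ K₁ M t v (k + 1)).1 =
      closedLoop A B K₀ (switchedTraj A B K₀ K₁ M t v k).1 + v k := by
  rw [switchedTraj_succ_fst, excessInput, if_pos h, ← closedLoop_apply, ← closedLoop_apply]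
  simp [act, map_sub]

lemma switchedTraj_succ_fst_of_not_fallback {v : ℕ → EuclideanSpace ℝ (Fin n)} {k : ℕ}
    (h : ¬ UsesFallback M (switchedTraj A B K₀ K₁ M t v k)) :
    (switchedTraj A B K₀ K₁ M t v (k + 1)).1 =
      closedLoop A B K₁ (switchedTraj A B K₀ K₁ M t v k).1 + v k := by
  rw [switchedTraj_succ_fst, excessInput, if_neg h]
  simp

/-- While the fallback gain is in use, the current fallback period was triggered `j < t` steps ago,
at a time when the counter vanished and the state was large. Since then the deviation of the state
from the noise response of the fallback loop has followed the noise-free fallback loop. -/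
lemma exists_trigger (ht : 1 ≤ t) (v : ℕ → EuclideanSpace ℝ (Fin n)) (k : ℕ)
    (h : UsesFallback M (switchedTraj A B K₀ K₁ M t v k)) :
    ∃ j < t, j ≤ k ∧ (switchedTraj A B K₀ K₁ M t v (k - j)).2 = 0 ∧
      M ≤ ‖(switchedTraj A B K₀ K₁ M t v (k - j)).1‖ ∧
      (switchedTraj A B K₀ K₁ M t v k).1 - linearTraj A B K₀ v k =
        (closedLoop A B K₀ ^ j)
          ((switchedTraj A B K₀ K₁ M t v (k - j)).1 - linearTraj A B K₀ v (k - j)) ∧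
      (switchedTraj A B K₀ K₁ M t v (k + 1)).2 + j + 1 = t := by
  induction k with
  | zero =>
    have h0 : (switchedTraj A B K₀ K₁ M t v 0).2 = 0 := rfl
    have hM : M ≤ ‖(switchedTraj A B K₀ K₁ M t v 0).1‖ := h.resolve_left (by omega)
    refine ⟨0, ht, le_rfl, h0, hM, by simp, ?_⟩
    rw [switchedTraj_succ_snd, h0, switchLogic_snd_of_le hM]; omega
  | succ k ih =>
    rcases Nat.eq_zero_or_pos (switchedTraj A B K₀ K₁ M t v (k + 1)).2 with h0 | h0
    · have hM := h.resolve_left (by omega)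
      refine ⟨0, ht, Nat.zero_le _, h0, hM, by simp, ?_⟩
      rw [switchedTraj_succ_snd, h0, switchLogic_snd_of_le hM]; omega
    · have hk : UsesFallback M (switchedTraj A B K₀ K₁ M t v k) := by
        by_contra hn
        simp only [UsesFallback, not_or, not_lt, not_le, Nat.le_zero] at hn
        rw [switchedTraj_succ_snd, hn.1, switchLogic_snd_of_lt hn.2] at h0
        exact h0.false
      obtain ⟨j, hjt, hjk, hξ, hM, hx, hc⟩ := ih hk
      refine ⟨j + 1, by omega, by omega, ?_, ?_, ?_, ?_⟩
      · simpa using hξ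
      · simpa using hM
      · rw [switchedTraj_succ_fst_of_fallback hk, linearTraj_succ, add_sub_add_right_eq_sub,
          ← map_sub, hx, pow_succ', Nat.add_sub_add_right]
        rfl
      · rw [switchedTraj_succ_snd, switchLogic_snd_of_pos _ h0]; omega

lemma act_sub {p q : ℕ} (A : Matrix (Fin p) (Fin q) ℝ) (x y : EuclideanSpace ℝ (Fin q)) :
    act A (x - y) = act A x - act A y :=
  map_sub (Matrix.toEuclideanLin A) x y

lemma continuous_act {p q : ℕ} (A : Matrix (Fin p) (Fin q) ℝ) : Continuous (act A) :=
  LinearMap.continuous_of_finiteDimensional _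

/-- The Euclidean operator norm of a rectangular matrix. -/
noncomputable def actNorm {p q : ℕ} (A : Matrix (Fin p) (Fin q) ℝ) : ℝ :=
  ‖LinearMap.toContinuousLinearMap (Matrix.toEuclideanLin A)‖

lemma norm_act_le {p q : ℕ} (A : Matrix (Fin p) (Fin q) ℝ) (x : EuclideanSpace ℝ (Fin q)) :
    ‖act A x‖ ≤ actNorm A * ‖x‖ :=
  (LinearMap.toContinuousLinearMap (Matrix.toEuclideanLin A)).le_opNorm x

lemma sq_norm_act_le {p q : ℕ} (A : Matrix (Fin p) (Fin q) ℝ) (x : EuclideanSpace ℝ (Fin q)) :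
    ‖act A x‖ ^ 2 ≤ actNorm A ^ 2 * ‖x‖ ^ 2 := by
  rw [← mul_pow]; gcongr; exact norm_act_le A x

lemma measurableSet_usesFallback (M : ℝ) :
    MeasurableSet {s : EuclideanSpace ℝ (Fin n) × ℕ | UsesFallback M s} :=
  (measurableSet_lt measurable_const measurable_snd).union
    (measurableSet_le measurable_const measurable_fst.norm)

lemma measurable_excessInput (K₀ K₁ : Matrix (Fin m) (Fin n) ℝ) (M : ℝ) :
    Measurable (excessInput K₀ K₁ M) :=
  Measurable.ite (measurableSet_usesFallback M)
    ((continuous_act _).measurable.comp measurable_fst) measurable_const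

lemma measurable_switchLogic_snd (K₀ K₁ : Matrix (Fin m) (Fin n) ℝ) (M : ℝ) (t : ℕ) :
    Measurable fun s : EuclideanSpace ℝ (Fin n) × ℕ => (switchLogic K₀ K₁ M t s.1 s.2).2 := by
  have e : (fun s : EuclideanSpace ℝ (Fin n) × ℕ => (switchLogic K₀ K₁ M t s.1 s.2).2) =
      fun s => if 0 < s.2 then s.2 - 1 else if M ≤ ‖s.1‖ then t - 1 else s.2 - 1 := by
    ext s; unfold switchLogic; split_ifs <;> rfl
  rw [e]
  exact Measurable.ite (measurableSet_lt measurable_const measurable_snd) (by fun_prop)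
    (Measurable.ite (measurableSet_le measurable_const measurable_fst.norm) (by fun_prop)
      (by fun_prop))

variable {Ω : Type*} [MeasurableSpace Ω] {μ : Measure Ω} {w : ℕ → Ω → EuclideanSpace ℝ (Fin n)}

lemma aemeasurable_switchedTraj (hw : ∀ k, AEMeasurable (w k) μ) (k : ℕ) :
    AEMeasurable (fun ω => switchedTraj A B K₀ K₁ M t (fun j => w j ω) k) μ := by
  induction k with
  | zero => exact aemeasurable_const
  | succ k ih =>
    refine AEMeasurable.prodMk ?_ ((measurable_switchLogic_snd K₀ K₁ M t).comp_aemeasurable ih)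
    change AEMeasurable
      (fun ω => (switchedTraj A B K₀ K₁ M t (fun j => w j ω) (k + 1)).1) μ
    simp_rw [switchedTraj_succ_fst]
    exact ((((closedLoop A B K₁).measurable.comp measurable_fst).comp_aemeasurable ih).add
      (((continuous_act B).measurable.comp
        (measurable_excessInput K₀ K₁ M)).comp_aemeasurable ih)).add (hw k)

end Trajectory

/-! ### Exponential moments at decision times -/

section Exponential

variable {n m : ℕ} {A : Matrix (Fin n) (Fin n) ℝ} {B : Matrix (Fin n) (Fin m) ℝ}
  {K₀ K₁ : Matrix (Fin m) (Fin n) ℝ} {M : ℝ} {t : ℕ} {P W : Matrix (Fin n) (Fin n) ℝ}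
  {r σ δ : ℝ}

/-- The weight `θ` for which `exp (θ xᵀ P x)` serves as an exponential Lyapunov function of the
switched loop. -/
noncomputable def lyapWeight (r σ : ℝ) (P : Matrix (Fin n) (Fin n) ℝ) : ℝ :=
  (1 - r) ^ 2 / (4 * σ * opNorm P)

/-- The exponential Lyapunov function `exp (θ xᵀ P x)`, counted only at decision times, that is,
when the counter vanishes. -/
noncomputable def decisionWeight (r σ : ℝ) (P : Matrix (Fin n) (Fin n) ℝ)
    (s : EuclideanSpace ℝ (Fin n) × ℕ) : ℝ :=
  if s.2 = 0 then Real.exp (lyapWeight r σ P * quad P s.1) else 0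

lemma decisionWeight_nonneg (s : EuclideanSpace ℝ (Fin n) × ℕ) : 0 ≤ decisionWeight r σ P s := by
  unfold decisionWeight; split_ifs <;> positivity

lemma measurable_decisionWeight : Measurable (decisionWeight (n := n) r σ P) := by
  refine Measurable.ite ((measurableSet_singleton 0).preimage measurable_snd) ?_ measurable_const
  have := (continuous_quad P).measurable
  fun_prop

lemma lyapWeight_mul_quad_le (hσ : 0 < σ) (hp : 0 < opNorm P) (x : EuclideanSpace ℝ (Fin n)) :
    lyapWeight r σ P * quad P x ≤ (1 - r) ^ 2 * (‖x‖ ^ 2 / (4 * σ)) := by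
  calc lyapWeight r σ P * quad P x ≤ lyapWeight r σ P * (opNorm P * ‖x‖ ^ 2) := by
        gcongr
        · unfold lyapWeight; positivity
        · exact quad_le P x
    _ = _ := by unfold lyapWeight; field_simp

/-- The choice `θ = (1 - r)² / (4 σ ‖P‖)` makes `θ V (a + b)` at most a convex combination, with
weights `r` and `1 - r`, of a multiple of `θ V a` and of `‖b‖² / (4 σ)`. -/
lemma exp_quad_add_le (hP : P.PosSemidef) (hr0 : 0 < r) (hr1 : r < 1) (hσ : 0 < σ)
    (hp : 0 < opNorm P) {a b : EuclideanSpace ℝ (Fin n)} {z : ℝ}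
    (hz : lyapWeight r σ P * quad P a ≤ r ^ 2 * z) :
    Real.exp (lyapWeight r σ P * quad P (a + b)) ≤
      r * Real.exp z + Real.exp (‖b‖ ^ 2 / (4 * σ)) := by
  have h1r : 0 < 1 - r := by linarith
  have hθ : 0 ≤ lyapWeight r σ P := by unfold lyapWeight; positivity
  have h1 : lyapWeight r σ P * quad P (a + b) ≤ r * z + (1 - r) * (‖b‖ ^ 2 / (4 * σ)) := by
    calc _ ≤ lyapWeight r σ P * (quad P a / r + quad P b / (1 - r)) := by
          gcongr; exact quad_add_le hP hr0 hr1 a b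
      _ = lyapWeight r σ P * quad P a / r + lyapWeight r σ P * quad P b / (1 - r) := by ring
      _ ≤ r ^ 2 * z / r + (1 - r) ^ 2 * (‖b‖ ^ 2 / (4 * σ)) / (1 - r) :=
          add_le_add (div_le_div_of_nonneg_right hz hr0.le)
            (div_le_div_of_nonneg_right (lyapWeight_mul_quad_le hσ hp b) h1r.le)
      _ = _ := by field_simp
  have h2 := convexOn_exp.2 (Set.mem_univ z) (Set.mem_univ (‖b‖ ^ 2 / (4 * σ))) hr0.le h1r.le
    (by ring)
  simp only [smul_eq_mul] at h2
  have h3 : (1 - r) * Real.exp (‖b‖ ^ 2 / (4 * σ)) ≤ 1 * Real.exp (‖b‖ ^ 2 / (4 * σ)) := by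
    gcongr; linarith
  linarith [Real.exp_le_exp.2 h1]

lemma exp_mul_half_add_le (hδ0 : 0 ≤ δ) (hδ1 : δ ≤ 1) (a b : ℝ) :
    Real.exp (δ * (a / 2 + b / 2)) ≤ δ * (Real.exp a + Real.exp b) + 1 := by
  have h1 := convexOn_exp.2 (Set.mem_univ a) (Set.mem_univ b)
    (by norm_num : (0 : ℝ) ≤ 1 / 2) (by norm_num : (0 : ℝ) ≤ 1 / 2) (by norm_num)
  have h2 := convexOn_exp.2 (Set.mem_univ (a / 2 + b / 2)) (Set.mem_univ 0) hδ0
    (by linarith : 0 ≤ 1 - δ) (by ring)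
  simp only [smul_eq_mul, mul_zero, add_zero, Real.exp_zero, mul_one] at h1 h2
  have e : (1 / 2 : ℝ) * a + 1 / 2 * b = a / 2 + b / 2 := by ring
  rw [e] at h1
  have h3 := mul_le_mul_of_nonneg_left h1 hδ0
  nlinarith [Real.exp_pos a, Real.exp_pos b]

lemma quad_sub_le (hP : P.PosSemidef) (a b : EuclideanSpace ℝ (Fin n)) :
    quad P (a - b) ≤ 2 * quad P a + 2 * quad P b := by
  have h := quad_add_le hP (by norm_num : (0 : ℝ) < 1 / 2) (by norm_num) a (-b)
  have e : quad P (-b) = quad P b := by simp [quad_eq_inner]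
  rw [← sub_eq_add_neg, e] at h
  norm_num at h
  linarith

/-- One-step drift of the exponential Lyapunov function along a path. A decision time is either
reached by one step of the primary loop, or it ends a full fallback period of length `t`. -/
lemma decisionWeight_succ_le (hP : P.PosSemidef) (hr0 : 0 < r) (hr1 : r < 1) (hσ : 0 < σ)
    (hp : 0 < opNorm P) (hLyap : ∀ x, quad P (closedLoop A B K₁ x) ≤ r ^ 4 * quad P x)
    (ht : 1 ≤ t) (hδ0 : 0 ≤ δ) (hδ1 : δ ≤ 1)
    (hcontr : ∀ x, quad P ((closedLoop A B K₀ ^ t) x) ≤ δ * r ^ 2 / 4 * quad P x)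
    (v : ℕ → EuclideanSpace ℝ (Fin n)) (k : ℕ) :
    decisionWeight r σ P (switchedTraj A B K₀ K₁ M t v (k + 1)) ≤
      r * decisionWeight r σ P (switchedTraj A B K₀ K₁ M t v k) +
      Real.exp (‖v k‖ ^ 2 / (4 * σ)) +
      r * δ * decisionWeight r σ P (switchedTraj A B K₀ K₁ M t v (k + 1 - t)) +
      r * δ * Real.exp (‖linearTraj A B K₀ v (k + 1 - t)‖ ^ 2 / (4 * σ)) + r +
      Real.exp (‖linearTraj A B K₀ v (k + 1)‖ ^ 2 / (4 * σ)) := by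
  have hθ : 0 ≤ lyapWeight r σ P := by unfold lyapWeight; positivity
  have hw1 := decisionWeight_nonneg (r := r) (σ := σ) (P := P) (switchedTraj A B K₀ K₁ M t v k)
  have hw2 := decisionWeight_nonneg (r := r) (σ := σ) (P := P)
    (switchedTraj A B K₀ K₁ M t v (k + 1 - t))
  have hrδ : 0 ≤ r * δ := by positivity
  by_cases hξ : (switchedTraj A B K₀ K₁ M t v (k + 1)).2 = 0
  swap
  · rw [decisionWeight, if_neg hξ]; positivity
  have hL : decisionWeight r σ P (switchedTraj A B K₀ K₁ M t v (k + 1)) =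
      Real.exp (lyapWeight r σ P * quad P (switchedTraj A B K₀ K₁ M t v (k + 1)).1) := if_pos hξ
  rw [hL]
  by_cases hF : UsesFallback M (switchedTraj A B K₀ K₁ M t v k)
  · obtain ⟨j, hjt, hjk, hξ', -, hx, hc⟩ := exists_trigger ht v k hF
    obtain rfl : t = j + 1 := by omega
    have e1 : k + 1 - (j + 1) = k - j := by omega
    rw [e1] at hw2 ⊢
    set x := (switchedTraj A B K₀ K₁ M (j + 1) v (k - j)).1 with hxd
    set y := linearTraj A B K₀ v (k - j) with hyd
    have e2 : (switchedTraj A B K₀ K₁ M (j + 1) v (k + 1)).1 =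
        (closedLoop A B K₀ ^ (j + 1)) (x - y) + linearTraj A B K₀ v (k + 1) := by
      rw [switchedTraj_succ_fst_of_fallback hF, linearTraj_succ, pow_succ',
        mul_apply_eq_comp, ← hx, map_sub]
      abel
    have hz : lyapWeight r σ P * quad P ((closedLoop A B K₀ ^ (j + 1)) (x - y)) ≤
        r ^ 2 * (δ * (lyapWeight r σ P * quad P x / 2 + lyapWeight r σ P * quad P y / 2)) := by
      calc _ ≤ lyapWeight r σ P * (δ * r ^ 2 / 4 * (2 * quad P x + 2 * quad P y)) := by
            gcongr
            exact (hcontr _).trans (by gcongr; exact quad_sub_le hP x y)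
        _ = _ := by ring
    have h1 := exp_quad_add_le (b := linearTraj A B K₀ v (k + 1)) hP hr0 hr1 hσ hp hz
    rw [e2]
    have h2 := exp_mul_half_add_le hδ0 hδ1 (lyapWeight r σ P * quad P x)
      (lyapWeight r σ P * quad P y)
    have h3 : Real.exp (lyapWeight r σ P * quad P y) ≤ Real.exp (‖y‖ ^ 2 / (4 * σ)) := by
      gcongr
      refine (lyapWeight_mul_quad_le hσ hp y).trans ?_
      exact mul_le_of_le_one_left (by positivity) (by nlinarith)
    have h4 : decisionWeight r σ P (switchedTraj A B K₀ K₁ M (j + 1) v (k - j)) =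
        Real.exp (lyapWeight r σ P * quad P x) := if_pos hξ'
    rw [h4]
    have h5 : r * Real.exp (δ * (lyapWeight r σ P * quad P x / 2 +
        lyapWeight r σ P * quad P y / 2)) ≤
        r * (δ * (Real.exp (lyapWeight r σ P * quad P x) + Real.exp (‖y‖ ^ 2 / (4 * σ))) + 1) := by
      gcongr
      exact h2.trans (by gcongr)
    have h6 : 0 ≤ r * decisionWeight r σ P (switchedTraj A B K₀ K₁ M (j + 1) v k) := by positivity
    have h7 := Real.exp_pos (‖v k‖ ^ 2 / (4 * σ))
    linarith
  · have hξk : (switchedTraj A B K₀ K₁ M t v k).2 = 0 := by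
      simp only [UsesFallback, not_or, not_lt, Nat.le_zero] at hF
      exact hF.1
    have h4 : decisionWeight r σ P (switchedTraj A B K₀ K₁ M t v k) =
        Real.exp (lyapWeight r σ P * quad P (switchedTraj A B K₀ K₁ M t v k).1) := if_pos hξk
    rw [switchedTraj_succ_fst_of_not_fallback hF, h4]
    have hz : lyapWeight r σ P *
        quad P (closedLoop A B K₁ (switchedTraj A B K₀ K₁ M t v k).1) ≤
        r ^ 2 * (lyapWeight r σ P * quad P (switchedTraj A B K₀ K₁ M t v k).1) := by
      have h0 := quad_nonneg hP (switchedTraj A B K₀ K₁ M t v k).1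
      calc _ ≤ lyapWeight r σ P * (r ^ 2 * quad P (switchedTraj A B K₀ K₁ M t v k).1) := by
            gcongr
            refine (hLyap _).trans ?_
            gcongr ?_ * _
            exact pow_le_pow_of_le_one hr0.le hr1.le (by norm_num)
        _ = _ := by ring
    have h1 := exp_quad_add_le (b := v k) hP hr0 hr1 hσ hp hz
    have h6 : 0 ≤ r * δ * decisionWeight r σ P (switchedTraj A B K₀ K₁ M t v (k + 1 - t)) := by
      positivity
    have h7 := Real.exp_pos (‖linearTraj A B K₀ v (k + 1)‖ ^ 2 / (4 * σ))
    have h8 : 0 ≤ r * δ * Real.exp (‖linearTraj A B K₀ v (k + 1 - t)‖ ^ 2 / (4 * σ)) := by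
      positivity
    linarith

variable {Ω : Type*} [MeasurableSpace Ω] {μ : Measure Ω} [IsProbabilityMeasure μ]
  {w : ℕ → Ω → EuclideanSpace ℝ (Fin n)}

/-- Uniform bound on the exponential Lyapunov function at decision times. -/
lemma meanLE_decisionWeight (hP : P.PosSemidef) (hr0 : 0 < r) (hr1 : r < 1) (hσ : 0 < σ)
    (hp : 0 < opNorm P) (hLyap : ∀ x, quad P (closedLoop A B K₁ x) ≤ r ^ 4 * quad P x)
    (ht : 1 ≤ t) (hδ0 : 0 ≤ δ) (hδ1 : r + r * δ < 1)
    (hcontr : ∀ x, quad P ((closedLoop A B K₀ ^ t) x) ≤ δ * r ^ 2 / 4 * quad P x)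
    (hδ : δ ≤ 1) (hw : ∀ k, AEMeasurable (w k) μ) {G : ℝ} (hG : 0 ≤ G)
    (hGw : ∀ k, MeanLE μ (fun ω => Real.exp (‖w k ω‖ ^ 2 / (4 * σ))) G)
    (hGη : ∀ k, MeanLE μ (fun ω => Real.exp
      (‖linearTraj A B K₀ (fun j => w j ω) k‖ ^ 2 / (4 * σ))) G) (k : ℕ) :
    MeanLE μ (fun ω => decisionWeight r σ P
      (switchedTraj A B K₀ K₁ M t (fun j => w j ω) k)) ((1 + 3 * G) / (1 - (r + r * δ))) := by
  have hden : 0 < 1 - (r + r * δ) := by linarith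
  have hrδ : 0 ≤ r * δ := by positivity
  set C := (1 + 3 * G) / (1 - (r + r * δ)) with hC
  have hC1 : C * (1 - (r + r * δ)) = 1 + 3 * G := div_mul_cancel₀ _ hden.ne'
  induction k using Nat.strong_induction_on with
  | _ k ih =>
    rcases k with _ | k
    · have e : (fun ω => decisionWeight r σ P
          (switchedTraj A B K₀ K₁ M t (fun j => w j ω) 0)) = fun _ => (1 : ℝ) := by
        ext ω; simp [decisionWeight, switchedTraj, quad]
      rw [e]
      refine (meanLE_const 1).trans ?_
      rw [hC, le_div_iff₀ hden]; linarith
    · -- The pathwise drift has mean at most `(r + r δ) C + 1 + 3 G = C`; for `t > k + 1` the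
      -- truncated time `k + 1 - t` is `0`, where the bound holds as well.
      refine MeanLE.mono (((((((ih k (by omega)).const_mul hr0.le).add (hGw k)).add
        ((ih (k + 1 - t) (by omega)).const_mul hrδ)).add
        ((hGη (k + 1 - t)).const_mul hrδ)).add (meanLE_const r)).add (hGη (k + 1)) |>.trans ?_)
        (measurable_decisionWeight.comp_aemeasurable (aemeasurable_switchedTraj hw _))
        (fun ω => decisionWeight_nonneg _)
        (fun ω => decisionWeight_succ_le hP hr0 hr1 hσ hp hLyap ht hδ0 hδ hcontr _ k)
      nlinarith

end Exponential

/-! ### Mean square of the excess input -/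

section Excess

variable {n m : ℕ} {A : Matrix (Fin n) (Fin n) ℝ} {B : Matrix (Fin n) (Fin m) ℝ}
  {K₀ K₁ : Matrix (Fin m) (Fin n) ℝ} {M : ℝ} {t : ℕ} {P : Matrix (Fin n) (Fin n) ℝ}
  {r σ c : ℝ}

lemma sq_norm_add_le {E : Type*} [SeminormedAddCommGroup E] (a b : E) :
    ‖a + b‖ ^ 2 ≤ 2 * ‖a‖ ^ 2 + 2 * ‖b‖ ^ 2 := by
  have h := pow_le_pow_left₀ (norm_nonneg _) (norm_add_le a b) 2
  linarith [add_sq_le (a := ‖a‖) (b := ‖b‖)]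

/-- Young's inequality against the indicator of a rare event: if `1 ≤ q² Z` there, then `‖y‖²` is
split into a multiple of `Z` and a small multiple of `‖y‖⁴`, the latter bounded by an exponential
moment. -/
lemma two_mul_sq_norm_le {E : Type*} [SeminormedAddCommGroup E] (hσ : 0 < σ) {q Z s : ℝ}
    (hs : 0 < s) (hZ : 1 ≤ q ^ 2 * Z) (y : E) :
    2 * ‖y‖ ^ 2 ≤ q ^ 2 / s * Z + s * (32 * σ ^ 2) * Real.exp (‖y‖ ^ 2 / (4 * σ)) := by
  have h1 := Real.quadratic_le_exp_of_nonneg (x := ‖y‖ ^ 2 / (4 * σ)) (by positivity)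
  set a := ‖y‖ ^ 2 / (4 * σ) with ha
  have ha0 : 0 ≤ a := by positivity
  have e : ‖y‖ ^ 2 = 4 * σ * a := by rw [ha]; field_simp
  have h2 : 2 * (4 * σ * a) ≤ 1 / s + s * (4 * σ * a) ^ 2 := by
    have : 1 / s + s * (4 * σ * a) ^ 2 - 2 * (4 * σ * a) = (s * (4 * σ * a) - 1) ^ 2 / s := by
      field_simp; ring
    have : 0 ≤ (s * (4 * σ * a) - 1) ^ 2 / s := by positivity
    linarith
  have h3 : 1 / s ≤ q ^ 2 / s * Z := by
    rw [div_mul_eq_mul_div]; gcongr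
  have h4 : s * (4 * σ * a) ^ 2 ≤ s * (32 * σ ^ 2) * Real.exp a := by
    have : a ^ 2 ≤ 2 * Real.exp a := by linarith
    calc s * (4 * σ * a) ^ 2 = s * (16 * σ ^ 2) * a ^ 2 := by ring
      _ ≤ s * (16 * σ ^ 2) * (2 * Real.exp a) := by gcongr
      _ = _ := by ring
  rw [e]; linarith

/-- Pathwise bound on the excess input at time `k`. A fallback period in progress was triggered at
a decision time `k - j` with a large state, where the decision weight is at least `exp (4 c M²)`. -/
lemma sq_norm_excessInput_le (hσ : 0 < σ) (hc : 0 < c)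
    (hcP : ∀ x, 4 * c * ‖x‖ ^ 2 ≤ lyapWeight r σ P * quad P x)
    (hM : 0 ≤ M) (ht : 1 ≤ t) {h : ℝ} (hh : 0 < h)
    (v : ℕ → EuclideanSpace ℝ (Fin n)) (k : ℕ) :
    ‖excessInput K₀ K₁ M (switchedTraj A B K₀ K₁ M t v k)‖ ^ 2 ≤
      actNorm (K₀ - K₁) ^ 2 *
      (Real.exp (-(2 * c * M ^ 2)) ^ 2 / h * ∑ i ∈ Finset.range (min t (k + 1)),
          decisionWeight r σ P (switchedTraj A B K₀ K₁ M t v (k - i)) +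
        h * (32 * σ ^ 2) * Real.exp (‖linearTraj A B K₀ v k‖ ^ 2 / (4 * σ)) +
        Real.exp (-(2 * c * M ^ 2)) * (2 / c + 2 + 64 * σ ^ 2) *
          ∑ i ∈ Finset.range (k + 1), ‖closedLoop A B K₀ ^ i‖ ^ 2 *
            (decisionWeight r σ P (switchedTraj A B K₀ K₁ M t v (k - i)) +
              Real.exp (‖linearTraj A B K₀ v (k - i)‖ ^ 2 / (4 * σ)))) := by
  have hZ0 : ∀ i, 0 ≤ decisionWeight r σ P (switchedTraj A B K₀ K₁ M t v i) :=
    fun i => decisionWeight_nonneg _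
  set q := Real.exp (-(2 * c * M ^ 2)) with hq
  have hq0 : 0 < q := Real.exp_pos _
  by_cases hF : UsesFallback M (switchedTraj A B K₀ K₁ M t v k)
  swap
  · rw [excessInput, if_neg hF, norm_zero]
    have : 0 ≤ ∑ i ∈ Finset.range (min t (k + 1)),
      decisionWeight r σ P (switchedTraj A B K₀ K₁ M t v (k - i)) :=
      Finset.sum_nonneg fun i _ => hZ0 _
    have : 0 ≤ ∑ i ∈ Finset.range (k + 1), ‖closedLoop A B K₀ ^ i‖ ^ 2 *
            (decisionWeight r σ P (switchedTraj A B K₀ K₁ M t v (k - i)) +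
              Real.exp (‖linearTraj A B K₀ v (k - i)‖ ^ 2 / (4 * σ))) :=
      Finset.sum_nonneg fun i _ => mul_nonneg (by positivity)
        (add_nonneg (hZ0 _) (Real.exp_pos _).le)
    rw [zero_pow two_ne_zero]
    positivity
  rw [excessInput, if_pos hF]
  refine (sq_norm_act_le _ _).trans (mul_le_mul_of_nonneg_left ?_ (by positivity))
  obtain ⟨j, hjt, hjk, hξ, hMx, hx, -⟩ := exists_trigger ht v k hF
  have hs1 := Finset.single_le_sum (s := Finset.range (min t (k + 1)))
    (f := fun i => decisionWeight r σ P (switchedTraj A B K₀ K₁ M t v (k - i)))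
    (fun i _ => hZ0 _) (Finset.mem_range.2 (lt_min hjt (by omega)) : j ∈ _)
  have hs2 := Finset.single_le_sum (s := Finset.range (k + 1))
    (f := fun i => ‖closedLoop A B K₀ ^ i‖ ^ 2 *
            (decisionWeight r σ P (switchedTraj A B K₀ K₁ M t v (k - i)) +
              Real.exp (‖linearTraj A B K₀ v (k - i)‖ ^ 2 / (4 * σ))))
    (fun i _ => mul_nonneg (by positivity) (add_nonneg (hZ0 _) (Real.exp_pos _).le))
    (Finset.mem_range.2 (by omega) : j ∈ _)
  set Z := decisionWeight r σ P (switchedTraj A B K₀ K₁ M t v (k - j)) with hZ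
  set x := (switchedTraj A B K₀ K₁ M t v (k - j)).1 with hxd
  set y := linearTraj A B K₀ v (k - j) with hyd
  set η := linearTraj A B K₀ v k with hη
  set G := Real.exp (‖y‖ ^ 2 / (4 * σ)) with hG
  have hZe : Z = Real.exp (lyapWeight r σ P * quad P x) := if_pos hξ
  have hMx2 : M ^ 2 ≤ ‖x‖ ^ 2 := by gcongr
  -- `exp (2 c ‖x‖²) ≤ q Z`, and hence `1 ≤ q² Z`, because `‖x‖ ≥ M`.
  have hexp : Real.exp (2 * c * ‖x‖ ^ 2) ≤ q * Z := by
    rw [hZe, hq, ← Real.exp_add]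
    gcongr
    have := hcP x
    have := mul_le_mul_of_nonneg_left hMx2 hc.le
    linarith
  have hone : 1 ≤ q ^ 2 * Z := by
    rw [hZe, hq, ← Real.exp_nat_mul, ← Real.exp_add]
    apply Real.one_le_exp
    have := hcP x
    have := mul_le_mul_of_nonneg_left hMx2 hc.le
    push_cast
    linarith
  have hxb : ‖x‖ ^ 2 ≤ 1 / (2 * c) * (q * Z) := by
    have := Real.add_one_le_exp (2 * c * ‖x‖ ^ 2)
    rw [div_mul_eq_mul_div, le_div_iff₀ (by positivity)]
    linarith
  have hyb := two_mul_sq_norm_le hσ hq0 hone y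
  have hηb := two_mul_sq_norm_le hσ hh hone η
  have hxk : (switchedTraj A B K₀ K₁ M t v k).1 = (closedLoop A B K₀ ^ j) (x - y) + η := by
    rw [← hx]; abel
  have hxy : ‖(closedLoop A B K₀ ^ j) (x - y)‖ ^ 2 ≤
      ‖closedLoop A B K₀ ^ j‖ ^ 2 * (2 * ‖x‖ ^ 2 + 2 * ‖y‖ ^ 2) := by
    calc _ ≤ (‖closedLoop A B K₀ ^ j‖ * ‖x - y‖) ^ 2 := by
          gcongr; exact ContinuousLinearMap.le_opNorm _ _
      _ = ‖closedLoop A B K₀ ^ j‖ ^ 2 * ‖x - y‖ ^ 2 := by ring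
      _ ≤ _ := by
          gcongr
          simpa [sub_eq_add_neg] using sq_norm_add_le x (-y)
  have hG0 : 0 < G := Real.exp_pos _
  have hZp : 0 ≤ Z := hZ0 _
  have hsum : 2 * (2 * ‖x‖ ^ 2 + 2 * ‖y‖ ^ 2) ≤ q * (2 / c + 2 + 64 * σ ^ 2) * (Z + G) := by
    have e1 : q ^ 2 / q * Z = q * Z := by field_simp
    rw [e1] at hyb
    have e2 : q * (2 / c + 2 + 64 * σ ^ 2) * (Z + G) - (4 * (1 / (2 * c) * (q * Z)) +
        2 * (q * Z + q * (32 * σ ^ 2) * G)) =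
        q * (2 / c + 2) * G + q * (64 * σ ^ 2) * Z := by field_simp; ring
    have e3 : 0 ≤ q * (2 / c + 2) * G + q * (64 * σ ^ 2) * Z := by positivity
    linarith
  rw [hxk]
  calc _ ≤ 2 * ‖(closedLoop A B K₀ ^ j) (x - y)‖ ^ 2 + 2 * ‖η‖ ^ 2 := sq_norm_add_le _ _
    _ ≤ ‖closedLoop A B K₀ ^ j‖ ^ 2 * (2 * (2 * ‖x‖ ^ 2 + 2 * ‖y‖ ^ 2)) + 2 * ‖η‖ ^ 2 := by
        linarith
    _ ≤ ‖closedLoop A B K₀ ^ j‖ ^ 2 * (q * (2 / c + 2 + 64 * σ ^ 2) * (Z + G)) +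
        (q ^ 2 / h * Z + h * (32 * σ ^ 2) * Real.exp (‖η‖ ^ 2 / (4 * σ))) := by gcongr
    _ = q ^ 2 / h * Z + h * (32 * σ ^ 2) * Real.exp (‖η‖ ^ 2 / (4 * σ)) +
        q * (2 / c + 2 + 64 * σ ^ 2) * (‖closedLoop A B K₀ ^ j‖ ^ 2 * (Z + G)) := by ring
    _ ≤ _ := by gcongr

variable {Ω : Type*} [MeasurableSpace Ω] {μ : Measure Ω} {w : ℕ → Ω → EuclideanSpace ℝ (Fin n)}

/-- The excess input has mean square `O(t^{1/2} exp (-2 c M²))`. -/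
lemma meanLE_sq_norm_excessInput (hσ : 0 < σ) (hc : 0 < c)
    (hcP : ∀ x, 4 * c * ‖x‖ ^ 2 ≤ lyapWeight r σ P * quad P x)
    (hM : 0 ≤ M) (ht : 1 ≤ t) (hw : ∀ k, AEMeasurable (w k) μ) {C G S : ℝ}
    (hC0 : 0 ≤ C) (hG0 : 0 ≤ G)
    (hS : ∀ k, ∑ i ∈ Finset.range k, ‖closedLoop A B K₀ ^ i‖ ^ 2 ≤ S)
    (hGη : ∀ k, MeanLE μ (fun ω => Real.exp
      (‖linearTraj A B K₀ (fun j => w j ω) k‖ ^ 2 / (4 * σ))) G)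
    (hZ : ∀ k, MeanLE μ (fun ω => decisionWeight r σ P
      (switchedTraj A B K₀ K₁ M t (fun j => w j ω) k)) C) (k : ℕ) :
    MeanLE μ (fun ω => ‖excessInput K₀ K₁ M (switchedTraj A B K₀ K₁ M t (fun j => w j ω) k)‖ ^ 2)
      (actNorm (K₀ - K₁) ^ 2 * (C + 32 * σ ^ 2 * G + (2 / c + 2 + 64 * σ ^ 2) * (S * (C + G))) *
        gapRate c (M, t) ^ 2) := by
  set q := Real.exp (-(2 * c * M ^ 2)) with hq
  have ht' : (1 : ℝ) ≤ t := by exact_mod_cast ht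
  have hg : gapRate c (M, t) ^ 2 = √t * q := by
    have e1 : ((t : ℝ) ^ (1 / 4 : ℝ)) ^ 2 = √t := by
      rw [← Real.rpow_natCast, ← Real.rpow_mul (by positivity), Real.sqrt_eq_rpow]
      norm_num
    have e2 : Real.exp (-c * M ^ 2) ^ 2 = q := by
      rw [← Real.exp_nat_mul, hq]
      congr 1
      push_cast
      ring
    rw [gapRate, mul_pow, e1, e2]
  set h := gapRate c (M, t) ^ 2 with hh
  have hq0 : 0 < q := Real.exp_pos _
  have hst : 1 ≤ √(t : ℝ) := Real.one_le_sqrt.2 ht'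
  have hh0 : 0 < h := by rw [hg]; positivity
  have hqh : q ≤ h := by rw [hg]; nlinarith
  have hqt : q ^ 2 / h * (t * C) = h * C := by
    have : q ^ 2 * t = h * h := by
      rw [hg]; nth_rewrite 1 [← Real.mul_self_sqrt (by positivity : (0 : ℝ) ≤ t)]; ring
    calc _ = q ^ 2 * t / h * C := by ring
      _ = _ := by rw [this]; field_simp
  have hbound := (((MeanLE.sum (s := Finset.range (min t (k + 1)))
      fun i _ => hZ (k - i)).const_mul (a := q ^ 2 / h) (by positivity)).add
    ((hGη k).const_mul (a := h * (32 * σ ^ 2)) (by positivity))).add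
    ((MeanLE.sum (s := Finset.range (k + 1)) fun i _ =>
      ((hZ (k - i)).add (hGη (k - i))).const_mul
        (a := ‖closedLoop A B K₀ ^ i‖ ^ 2) (by positivity)).const_mul
          (a := q * (2 / c + 2 + 64 * σ ^ 2)) (by positivity))
  refine ((hbound.const_mul (a := actNorm (K₀ - K₁) ^ 2) (by positivity)).mono ?_
    (fun ω => by positivity)
    (fun ω => sq_norm_excessInput_le hσ hc hcP hM ht hh0 (fun j => w j ω) k)).trans ?_
  · exact ((measurable_excessInput K₀ K₁ M).comp_aemeasurable
      (aemeasurable_switchedTraj hw k)).norm.pow_const 2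
  · rw [mul_assoc (actNorm (K₀ - K₁) ^ 2)]
    refine mul_le_mul_of_nonneg_left ?_ (by positivity)
    rw [Finset.sum_const, Finset.card_range, nsmul_eq_mul, ← Finset.sum_mul]
    have h1 : q ^ 2 / h * ((min t (k + 1) : ℕ) * C) ≤ h * C := by
      rw [← hqt]; gcongr; exact min_le_left _ _
    have h2 : q * (2 / c + 2 + 64 * σ ^ 2) *
        ((∑ i ∈ Finset.range (k + 1), ‖closedLoop A B K₀ ^ i‖ ^ 2) * (C + G)) ≤
        h * (2 / c + 2 + 64 * σ ^ 2) * (S * (C + G)) := by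
      gcongr
      exact hS _
    linarith

end Excess

/-! ### Comparison with the primary loop -/

section Comparison

variable {n m : ℕ} {A : Matrix (Fin n) (Fin n) ℝ} {B : Matrix (Fin n) (Fin m) ℝ}
  {K₀ K₁ : Matrix (Fin m) (Fin n) ℝ} {M : ℝ} {t : ℕ} {P : Matrix (Fin n) (Fin n) ℝ} {r : ℝ}
  {Ω : Type*} [MeasurableSpace Ω] {μ : Measure Ω}

/-- A stable recursion driven by an input of bounded mean square stays bounded in mean square. -/
lemma meanLE_quad_of_recursion [IsProbabilityMeasure μ] (hP : P.PosSemidef) (hr0 : 0 < r)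
    (hr1 : r < 1) (hLyap : ∀ x, quad P (closedLoop A B K₁ x) ≤ r ^ 4 * quad P x)
    {d e : ℕ → Ω → EuclideanSpace ℝ (Fin n)} (hd : ∀ k, AEMeasurable (d k) μ)
    (h0 : ∀ ω, d 0 ω = 0) (hrec : ∀ k ω, d (k + 1) ω = closedLoop A B K₁ (d k ω) + e k ω)
    {L : ℝ} (he : ∀ k, MeanLE μ (fun ω => ‖e k ω‖ ^ 2) L) (k : ℕ) :
    MeanLE μ (fun ω => quad P (d k ω)) (opNorm P / (1 - r) ^ 2 * L) := by
  have h1r : 0 < 1 - r := by linarith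
  have hL : 0 ≤ L := (integral_nonneg fun ω => by positivity).trans (he 0).2
  have hp := opNorm_nonneg P
  induction k with
  | zero =>
    have : (fun ω => quad P (d 0 ω)) = fun _ => (0 : ℝ) := by
      ext ω; rw [h0]; simp [quad]
    rw [this]
    exact (meanLE_const 0).trans (by positivity)
  | succ k ih =>
    refine (((ih.const_mul hr0.le).add ((he k).const_mul (a := opNorm P / (1 - r))
      (by positivity))).mono ((continuous_quad P).measurable.comp_aemeasurable (hd _))
      (fun ω => quad_nonneg hP _) fun ω => ?_).trans (le_of_eq ?_)
    · rw [Function.comp_apply, hrec]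
      refine (quad_add_le hP hr0 hr1 _ _).trans (add_le_add ?_ ?_)
      · rw [div_le_iff₀ hr0]
        refine (hLyap _).trans ?_
        have h2 : r ^ 4 ≤ r * r := by
          rw [← sq]; exact pow_le_pow_of_le_one hr0.le hr1.le (by norm_num)
        nlinarith [mul_le_mul_of_nonneg_right h2 (quad_nonneg hP (d k ω))]
      · rw [div_mul_eq_mul_div]
        gcongr
        exact quad_le P _
    · field_simp; ring

lemma meanLE_sq_norm_of_quad (hP : P.PosDef) {d : Ω → EuclideanSpace ℝ (Fin n)}
    (hd : AEMeasurable d μ) {L : ℝ} (h : MeanLE μ (fun ω => quad P (d ω)) L) :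
    MeanLE μ (fun ω => ‖d ω‖ ^ 2) (opNorm P⁻¹ * L) :=
  (h.const_mul (opNorm_nonneg _)).mono (hd.norm.pow_const 2) (fun _ => by positivity)
    fun ω => sq_norm_le_quad hP (d ω)

end Comparison

/-! ### Comparison of costs -/

section Cost

variable {n m : ℕ} {Ω : Type*} [MeasurableSpace Ω] {μ : Measure Ω}
  {Q : Matrix (Fin n) (Fin n) ℝ} {R : Matrix (Fin m) (Fin m) ℝ}

/-- Stage costs that differ by at most `b` in the mean have long-run averages that differ by at most
`b`. -/
lemma lqCost_le_add {x x' : ℕ → Ω → EuclideanSpace ℝ (Fin n)}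
    {u u' : ℕ → Ω → EuclideanSpace ℝ (Fin m)} {e : ℕ → Ω → ℝ} {b : ℝ} (he0 : ∀ k ω, 0 ≤ e k ω)
    (he : ∀ k, MeanLE μ (e k) b)
    (h : ∀ k ω, quad Q (x k ω) + quad R (u k ω) ≤
      quad Q (x' k ω) + quad R (u' k ω) + e k ω) :
    lqCost μ Q R x u ≤ lqCost μ Q R x' u' + ENNReal.ofReal b := by
  unfold lqCost
  have key : ∀ T : ℕ, (T : ℝ≥0∞)⁻¹ *
      ∫⁻ ω, ENNReal.ofReal (∑ k ∈ Finset.range T, (quad Q (x k ω) + quad R (u k ω))) ∂μ ≤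
      (T : ℝ≥0∞)⁻¹ *
      ∫⁻ ω, ENNReal.ofReal (∑ k ∈ Finset.range T, (quad Q (x' k ω) + quad R (u' k ω))) ∂μ +
      ENNReal.ofReal b := by
    intro T
    have hs := MeanLE.sum (s := Finset.range T) fun k _ => he k
    have h1 : ∫⁻ ω, ENNReal.ofReal (∑ k ∈ Finset.range T, e k ω) ∂μ ≤
        T * ENNReal.ofReal b := by
      rw [← ofReal_integral_eq_lintegral_ofReal hs.1
        (Eventually.of_forall fun ω => Finset.sum_nonneg fun k _ => he0 k ω),
        ← ENNReal.ofReal_natCast, ← ENNReal.ofReal_mul (Nat.cast_nonneg _)]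
      refine ENNReal.ofReal_le_ofReal (hs.2.trans (le_of_eq ?_))
      simp
    have h2 : ∫⁻ ω, ENNReal.ofReal (∑ k ∈ Finset.range T, (quad Q (x k ω) + quad R (u k ω))) ∂μ ≤
        ∫⁻ ω, ENNReal.ofReal (∑ k ∈ Finset.range T, (quad Q (x' k ω) + quad R (u' k ω))) ∂μ +
        T * ENNReal.ofReal b := by
      refine le_trans ?_ (add_le_add_right h1 _)
      rw [← lintegral_add_right' _ hs.1.aemeasurable.ennreal_ofReal]
      refine lintegral_mono fun ω => ?_
      refine (ENNReal.ofReal_le_ofReal ?_).trans ENNReal.ofReal_add_le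
      rw [← Finset.sum_add_distrib]
      exact Finset.sum_le_sum fun k _ => h k ω
    refine (mul_le_mul_right h2 _).trans ?_
    rw [mul_add, ← mul_assoc]
    gcongr
    exact mul_le_of_le_one_left zero_le (ENNReal.inv_mul_le_one _)
  refine (limsup_le_limsup (Eventually.of_forall key)).trans (le_of_eq ?_)
  exact limsup_add_const atTop _ _ (by isBoundedDefault) (by isBoundedDefault)

lemma lqCost_ne_top {x : ℕ → Ω → EuclideanSpace ℝ (Fin n)} {u : ℕ → Ω → EuclideanSpace ℝ (Fin m)}
    {b₁ b₂ : ℝ}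
    (hx : ∀ k, MeanLE μ (fun ω => ‖x k ω‖ ^ 2) b₁) (hu : ∀ k, MeanLE μ (fun ω => ‖u k ω‖ ^ 2) b₂) :
    lqCost μ Q R x u ≠ ∞ := by
  have hb : ∀ k, MeanLE μ (fun ω => opNorm Q * ‖x k ω‖ ^ 2 + opNorm R * ‖u k ω‖ ^ 2)
      (opNorm Q * b₁ + opNorm R * b₂) := fun k =>
    ((hx k).const_mul (opNorm_nonneg Q)).add ((hu k).const_mul (opNorm_nonneg R))
  have h := lqCost_le_add (Q := Q) (R := R) (x := x) (u := u) (x' := fun _ _ => 0)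
    (u' := fun _ _ => 0) (fun k ω => add_nonneg (mul_nonneg (opNorm_nonneg Q) (by positivity))
      (mul_nonneg (opNorm_nonneg R) (by positivity))) hb fun k ω => by
        have h1 := quad_le Q (x k ω)
        have h2 := quad_le R (u k ω)
        simp only [quad] at h1 h2 ⊢
        simp
        linarith
  refine (h.trans_lt ?_).ne
  simp [lqCost, quad]

/-- If the states and the inputs of two processes differ by `O(h)` in mean square, their costs
differ by `O(h)`. -/
lemma lqCost_sub_le {x y : ℕ → Ω → EuclideanSpace ℝ (Fin n)}
    {u v : ℕ → Ω → EuclideanSpace ℝ (Fin m)} {h a₁ a₂ b₁ b₂ : ℝ} (hh : 0 < h) (hh1 : h ≤ 1)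
    (hy : ∀ k, MeanLE μ (fun ω => ‖y k ω‖ ^ 2) a₁) (hv : ∀ k, MeanLE μ (fun ω => ‖v k ω‖ ^ 2) a₂)
    (hd : ∀ k, MeanLE μ (fun ω => ‖x k ω - y k ω‖ ^ 2) (b₁ * h ^ 2))
    (he : ∀ k, MeanLE μ (fun ω => ‖u k ω - v k ω‖ ^ 2) (b₂ * h ^ 2))
    (hne : lqCost μ Q R y v ≠ ∞) :
    lqCost μ Q R x u ≠ ∞ ∧ |(lqCost μ Q R x u).toReal - (lqCost μ Q R y v).toReal| ≤
      (opNorm Q * (2 * b₁ + a₁) + opNorm R * (2 * b₂ + a₂)) * h := by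
  set b := (opNorm Q * (2 * b₁ + a₁) + opNorm R * (2 * b₂ + a₂)) * h with hb
  let e : ℕ → Ω → ℝ := fun k ω =>
    opNorm Q * (2 / h * ‖x k ω - y k ω‖ ^ 2 + h * ‖y k ω‖ ^ 2) +
    opNorm R * (2 / h * ‖u k ω - v k ω‖ ^ 2 + h * ‖v k ω‖ ^ 2)
  have hQ0 := opNorm_nonneg Q
  have hR0 := opNorm_nonneg R
  have he0 : ∀ k ω, 0 ≤ e k ω := fun k ω => by positivity
  have heb : ∀ k, MeanLE μ (e k) b := fun k =>
    ((((((hd k).const_mul (a := 2 / h) (by positivity)).add ((hy k).const_mul hh.le)).const_mul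
      hQ0).add ((((he k).const_mul (a := 2 / h) (by positivity)).add
        ((hv k).const_mul hh.le)).const_mul hR0))).trans (le_of_eq (by rw [hb]; field_simp))
  have hdiff : ∀ k ω, |(quad Q (x k ω) + quad R (u k ω)) - (quad Q (y k ω) + quad R (v k ω))| ≤
      e k ω := fun k ω => by
    have h1 := abs_quad_add_sub_le Q (y k ω) (x k ω - y k ω) hh hh1
    have h2 := abs_quad_add_sub_le R (v k ω) (u k ω - v k ω) hh hh1
    rw [add_sub_cancel] at h1 h2
    rw [add_sub_add_comm]
    exact (abs_add_le _ _).trans (add_le_add h1 h2)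
  have hb0 : 0 ≤ b := (integral_nonneg fun ω => he0 0 ω).trans (heb 0).2
  have h1 : lqCost μ Q R x u ≤ lqCost μ Q R y v + ENNReal.ofReal b :=
    lqCost_le_add he0 heb fun k ω => by linarith [(abs_le.1 (hdiff k ω)).2]
  have h2 : lqCost μ Q R y v ≤ lqCost μ Q R x u + ENNReal.ofReal b :=
    lqCost_le_add he0 heb fun k ω => by linarith [(abs_le.1 (hdiff k ω)).1]
  have hne' : lqCost μ Q R x u ≠ ∞ :=
    (h1.trans_lt (ENNReal.add_lt_top.2 ⟨hne.lt_top, ENNReal.ofReal_lt_top⟩)).ne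
  refine ⟨hne', ?_⟩
  have h1' := ENNReal.toReal_mono (ENNReal.add_ne_top.2 ⟨hne, ENNReal.ofReal_ne_top⟩) h1
  have h2' := ENNReal.toReal_mono (ENNReal.add_ne_top.2 ⟨hne', ENNReal.ofReal_ne_top⟩) h2
  rw [ENNReal.toReal_add hne ENNReal.ofReal_ne_top, ENNReal.toReal_ofReal hb0] at h1'
  rw [ENNReal.toReal_add hne' ENNReal.ofReal_ne_top, ENNReal.toReal_ofReal hb0] at h2'
  rw [abs_le]
  constructor <;> linarith

end Cost

/-! ### The cost gap -/

section Gap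

variable {n m : ℕ} {A : Matrix (Fin n) (Fin n) ℝ} {B : Matrix (Fin n) (Fin m) ℝ}
  {K₀ K₁ : Matrix (Fin m) (Fin n) ℝ} {P W : Matrix (Fin n) (Fin n) ℝ}
  {Ω : Type*} [MeasurableSpace Ω] {μ : Measure Ω} {w : ℕ → Ω → EuclideanSpace ℝ (Fin n)}

/-- A long fallback period contracts `V` by any prescribed factor. -/
lemma exists_quad_pow_le (hP : P.PosDef) (hK₀ : IsStabilizing A B K₀) {ε : ℝ} (hε : 0 < ε) :
    ∃ t₀ : ℕ, ∀ t ≥ t₀, ∀ x, quad P ((closedLoop A B K₀ ^ t) x) ≤ ε * quad P x := by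
  obtain ⟨C, q, hC, hq0, hq1, hpow⟩ := exists_norm_closedLoop_pow_le hK₀
  have hlim : Tendsto (fun t : ℕ => opNorm P * (C * q ^ t) ^ 2 * opNorm P⁻¹) atTop (𝓝 0) := by
    have h := tendsto_pow_atTop_nhds_zero_of_lt_one hq0.le hq1
    simpa using (((h.const_mul C).pow 2).const_mul (opNorm P)).mul_const (opNorm P⁻¹)
  obtain ⟨t₀, ht₀⟩ := eventually_atTop.1 (hlim.eventually (gt_mem_nhds hε))
  refine ⟨t₀, fun t ht x => ?_⟩
  have hp := opNorm_nonneg P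
  have hV := quad_nonneg hP.posSemidef x
  calc _ ≤ opNorm P * ‖(closedLoop A B K₀ ^ t) x‖ ^ 2 := quad_le _ _
    _ ≤ opNorm P * (C * q ^ t * ‖x‖) ^ 2 := by
        gcongr
        exact (ContinuousLinearMap.le_opNorm _ _).trans (by gcongr; exact hpow t)
    _ = opNorm P * (C * q ^ t) ^ 2 * ‖x‖ ^ 2 := by ring
    _ ≤ opNorm P * (C * q ^ t) ^ 2 * (opNorm P⁻¹ * quad P x) := by
        gcongr; exact sq_norm_le_quad hP x
    _ = opNorm P * (C * q ^ t) ^ 2 * opNorm P⁻¹ * quad P x := by ring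
    _ ≤ _ := by gcongr; exact (ht₀ t ht).le

lemma exists_sum_sq_norm_pow_le (hK₀ : IsStabilizing A B K₀) :
    ∃ S, ∀ k, ∑ i ∈ Finset.range k, ‖closedLoop A B K₀ ^ i‖ ^ 2 ≤ S := by
  obtain ⟨C, q, hC, hq0, hq1, hpow⟩ := exists_norm_closedLoop_pow_le hK₀
  have hs : Summable fun i : ℕ => ‖closedLoop A B K₀ ^ i‖ ^ 2 := by
    refine Summable.of_nonneg_of_le (fun i => by positivity) (fun i => ?_)
      ((summable_geometric_of_lt_one (sq_nonneg q) (by nlinarith : q ^ 2 < 1)).mul_left (C ^ 2))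
    calc _ ≤ (C * q ^ i) ^ 2 := by gcongr; exact hpow i
      _ = _ := by ring
  exact ⟨_, fun k => hs.sum_le_tsum _ fun i _ => by positivity⟩

/-- The deviation of the switched trajectory from the primary one is driven through the primary
closed loop by the excess input alone. -/
lemma switchedTraj_sub_linearTraj_succ (M : ℝ) (t : ℕ) (v : ℕ → EuclideanSpace ℝ (Fin n))
    (k : ℕ) :
    (switchedTraj A B K₀ K₁ M t v (k + 1)).1 - linearTraj A B K₁ v (k + 1) =
      closedLoop A B K₁ ((switchedTraj A B K₀ K₁ M t v k).1 - linearTraj A B K₁ v k) +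
        act B (excessInput K₀ K₁ M (switchedTraj A B K₀ K₁ M t v k)) := by
  rw [switchedTraj_succ_fst, linearTraj_succ, map_sub]
  abel

/-- In dimension zero there is no state, so every cost vanishes. -/
lemma linearCost_eq_zero_of_isEmpty [IsEmpty (Fin n)] (Q : Matrix (Fin n) (Fin n) ℝ)
    (R : Matrix (Fin m) (Fin m) ℝ) : linearCost μ A B Q R K₁ w = 0 := by
  have h : ∀ k ω, linearTraj A B K₁ (fun j => w j ω) k = 0 := fun _ _ => Subsingleton.elim _ _
  simp [linearCost, lqCost, h, quad]

lemma switchedCost_eq_zero_of_isEmpty [IsEmpty (Fin n)] (Q : Matrix (Fin n) (Fin n) ℝ)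
    (R : Matrix (Fin m) (Fin m) ℝ) (M : ℝ) (t : ℕ) :
    switchedCost μ A B Q R K₀ K₁ w M t = 0 := by
  have h : ∀ k ω, (switchedTraj A B K₀ K₁ M t (fun j => w j ω) k).1 = 0 :=
    fun _ _ => Subsingleton.elim _ _
  simp [switchedCost, lqCost, switchedInput_eq, excessInput, h, quad]

variable [IsProbabilityMeasure μ]

/-- The two loops have finite costs, which differ by `O(t^{1/4} exp (-c M²))` as soon as the
fallback periods are long enough and the rate is at most one. -/
lemma exists_cost_gap_le [NeZero n] (Q : Matrix (Fin n) (Fin n) ℝ) (R : Matrix (Fin m) (Fin m) ℝ)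
    (hW : W.PosDef) (hw_indep : iIndepFun w μ)
    (hw_law : ∀ k, HasLaw (w k) (multivariateGaussian 0 W) μ) (hK₀ : IsStabilizing A B K₀)
    {ρ : ℝ} (hρ₀ : 0 < ρ) (hρ₁ : ρ < 1) (hP : P.PosDef)
    (hLyap : (ρ • P - (A + B * K₁)ᵀ * P * (A + B * K₁)).PosDef) :
    linearCost μ A B Q R K₁ w ≠ ∞ ∧ ∃ (C : ℝ) (t₀ : ℕ), ∀ M : ℝ, 0 ≤ M → ∀ t ≥ t₀,
      gapRate (rateConst A B K₀ W ρ P) (M, t) ≤ 1 →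
      switchedCost μ A B Q R K₀ K₁ w M t ≠ ∞ ∧
      |(switchedCost μ A B Q R K₀ K₁ w M t).toReal - (linearCost μ A B Q R K₁ w).toReal| ≤
        C * gapRate (rateConst A B K₀ W ρ P) (M, t) := by
  set r := ρ ^ (1 / 4 : ℝ) with hr
  have hr0 : 0 < r := by positivity
  have hr1 : r < 1 := Real.rpow_lt_one hρ₀.le hρ₁ (by norm_num)
  have hr4 : r ^ 4 = ρ := by
    rw [hr, ← Real.rpow_natCast, ← Real.rpow_mul hρ₀.le]; norm_num
  have h1r : 0 < 1 - r := by linarith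
  set σ := opNorm (stationaryCov A B K₀ W) with hσd
  have hσ : 0 < σ := opNorm_stationaryCov_pos hW hK₀
  have hp : 0 < opNorm P := opNorm_pos hP
  have hp' : 0 < opNorm P⁻¹ := opNorm_pos hP.inv
  set c := rateConst A B K₀ W ρ P with hcd
  have hce : c = (1 - r) ^ 2 / (16 * σ * opNorm P * opNorm P⁻¹) := rfl
  have hc : 0 < c := by rw [hce]; positivity
  have hcP : ∀ x, 4 * c * ‖x‖ ^ 2 ≤ lyapWeight r σ P * quad P x := fun x => by
    calc 4 * c * ‖x‖ ^ 2 ≤ 4 * c * (opNorm P⁻¹ * quad P x) := by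
          gcongr; exact sq_norm_le_quad hP x
      _ = _ := by rw [hce, lyapWeight]; field_simp; ring
  have hL : ∀ x, quad P (closedLoop A B K₁ x) ≤ r ^ 4 * quad P x := fun x => by
    rw [hr4]; exact quad_closedLoop_le hLyap x
  have hwm : ∀ k, AEMeasurable (w k) μ := fun k => (hw_law k).aemeasurable
  have hGw := meanLE_exp_noise hW.posSemidef hw_law hK₀ hσ
  have hGη := meanLE_exp_linearTraj hW.posSemidef hw_indep hw_law hK₀ hσ
  set G := gaussConst n
  have hG : 0 ≤ G := gaussConst_nonneg n
  have hw2 : ∀ k, MeanLE μ (fun ω => ‖w k ω‖ ^ 2) (4 * σ * G) := fun k =>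
    ((hGw k).const_mul (a := 4 * σ) (by positivity)).mono ((hwm k).norm.pow_const 2)
      (fun _ => by positivity) fun ω => by
        have := Real.add_one_le_exp (‖w k ω‖ ^ 2 / (4 * σ))
        calc ‖w k ω‖ ^ 2 = 4 * σ * (‖w k ω‖ ^ 2 / (4 * σ)) := by field_simp
          _ ≤ _ := by gcongr; linarith
  have hym : ∀ k, AEMeasurable (fun ω => linearTraj A B K₁ (fun j => w j ω) k) μ :=
    aemeasurable_linearTraj hwm
  have hy : ∀ k, MeanLE μ (fun ω => ‖linearTraj A B K₁ (fun j => w j ω) k‖ ^ 2)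
      (opNorm P⁻¹ * (opNorm P / (1 - r) ^ 2 * (4 * σ * G))) := fun k =>
    meanLE_sq_norm_of_quad hP (hym k) (meanLE_quad_of_recursion
      (d := fun k ω => linearTraj A B K₁ (fun j => w j ω) k) (e := w) hP.posSemidef hr0 hr1 hL
      hym (fun _ => rfl) (fun k ω => linearTraj_succ _ k) hw2 k)
  set Y := opNorm P⁻¹ * (opNorm P / (1 - r) ^ 2 * (4 * σ * G)) with hY
  have hv : ∀ k, MeanLE μ (fun ω => ‖act K₁ (linearTraj A B K₁ (fun j => w j ω) k)‖ ^ 2)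
      (actNorm K₁ ^ 2 * Y) := fun k =>
    ((hy k).const_mul (by positivity)).mono
      (((continuous_act K₁).measurable.comp_aemeasurable (hym k)).norm.pow_const 2)
      (fun _ => by positivity) fun ω => sq_norm_act_le _ _
  have hfin : linearCost μ A B Q R K₁ w ≠ ∞ := lqCost_ne_top hy hv
  refine ⟨hfin, ?_⟩
  -- With this contraction of a fallback period the two drift factors satisfy `r + r δ < 1`.
  set δ := (1 - r) / 2 with hδ
  have hδ0 : 0 < δ := by positivity
  obtain ⟨t₁, ht₁⟩ := exists_quad_pow_le (A := A) (B := B) (K₀ := K₀) hP hK₀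
    (ε := δ * r ^ 2 / 4) (by positivity)
  obtain ⟨S, hS⟩ := exists_sum_sq_norm_pow_le hK₀
  have hrδ : r + r * δ < 1 := by rw [hδ]; nlinarith
  set Z := (1 + 3 * G) / (1 - (r + r * δ)) with hZ
  have hZ0 : 0 ≤ Z := div_nonneg (by positivity) (by linarith)
  set E := actNorm (K₀ - K₁) ^ 2 * (Z + 32 * σ ^ 2 * G +
    (2 / c + 2 + 64 * σ ^ 2) * (S * (Z + G))) with hE
  set D := opNorm P⁻¹ * (opNorm P / (1 - r) ^ 2 * (actNorm B ^ 2 * E)) with hD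
  refine ⟨opNorm Q * (2 * D + Y) + opNorm R * (2 * (2 * actNorm K₁ ^ 2 * D + 2 * E) +
    actNorm K₁ ^ 2 * Y), max t₁ 1, fun M hM t ht hg1 => ?_⟩
  have ht1 : 1 ≤ t := le_trans (le_max_right _ _) ht
  have hg0 : 0 < gapRate c (M, t) := by
    have : (0 : ℝ) < t := by exact_mod_cast ht1
    simp only [gapRate]; positivity
  have hxm := fun k => aemeasurable_switchedTraj (A := A) (B := B) (K₀ := K₀) (K₁ := K₁) (M := M)
    (t := t) hwm k
  have hZk := meanLE_decisionWeight (A := A) (B := B) (K₀ := K₀) (K₁ := K₁) (M := M) hP.posSemidef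
    hr0 hr1 hσ hp hL ht1 hδ0.le hrδ (ht₁ t (le_trans (le_max_left _ _) ht)) (by rw [hδ]; linarith)
    hwm hG hGw hGη
  have hs := meanLE_sq_norm_excessInput (K₁ := K₁) hσ hc hcP hM ht1 hwm hZ0 hG hS hGη hZk
  have hsm : ∀ k, AEMeasurable (fun ω => excessInput K₀ K₁ M
      (switchedTraj A B K₀ K₁ M t (fun j => w j ω) k)) μ := fun k =>
    (measurable_excessInput K₀ K₁ M).comp_aemeasurable (hxm k)
  have hBs : ∀ k, MeanLE μ (fun ω => ‖act B (excessInput K₀ K₁ M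
      (switchedTraj A B K₀ K₁ M t (fun j => w j ω) k))‖ ^ 2)
      (actNorm B ^ 2 * (E * gapRate c (M, t) ^ 2)) := fun k =>
    ((hs k).const_mul (by positivity)).mono
      (((continuous_act B).measurable.comp_aemeasurable (hsm k)).norm.pow_const 2)
      (fun _ => by positivity) fun ω => sq_norm_act_le _ _
  have hdm : ∀ k, AEMeasurable (fun ω => (switchedTraj A B K₀ K₁ M t (fun j => w j ω) k).1 -
      linearTraj A B K₁ (fun j => w j ω) k) μ := fun k =>
    (measurable_fst.comp_aemeasurable (hxm k)).sub (hym k)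
  have hd : ∀ k, MeanLE μ (fun ω => ‖(switchedTraj A B K₀ K₁ M t (fun j => w j ω) k).1 -
      linearTraj A B K₁ (fun j => w j ω) k‖ ^ 2) (D * gapRate c (M, t) ^ 2) := fun k =>
    (meanLE_sq_norm_of_quad hP (hdm k) (meanLE_quad_of_recursion
      (d := fun k ω => (switchedTraj A B K₀ K₁ M t (fun j => w j ω) k).1 -
        linearTraj A B K₁ (fun j => w j ω) k)
      (e := fun k ω => act B (excessInput K₀ K₁ M
        (switchedTraj A B K₀ K₁ M t (fun j => w j ω) k)))
      hP.posSemidef hr0 hr1 hL hdm (fun _ => sub_self _)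
      (fun k ω => switchedTraj_sub_linearTraj_succ M t _ k) hBs k)).trans
      (le_of_eq (by rw [hD]; ring))
  have he : ∀ k, MeanLE μ (fun ω => ‖switchedInput A B K₀ K₁ M t (fun j => w j ω) k -
      act K₁ (linearTraj A B K₁ (fun j => w j ω) k)‖ ^ 2)
      ((2 * actNorm K₁ ^ 2 * D + 2 * E) * gapRate c (M, t) ^ 2) := fun k => by
    have e1 : ∀ ω, switchedInput A B K₀ K₁ M t (fun j => w j ω) k -
        act K₁ (linearTraj A B K₁ (fun j => w j ω) k) =
        act K₁ ((switchedTraj A B K₀ K₁ M t (fun j => w j ω) k).1 -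
          linearTraj A B K₁ (fun j => w j ω) k) +
        excessInput K₀ K₁ M (switchedTraj A B K₀ K₁ M t (fun j => w j ω) k) := fun ω => by
      rw [switchedInput_eq, act_sub]
      abel
    simp_rw [e1]
    refine ((((hd k).const_mul (a := 2 * actNorm K₁ ^ 2) (by positivity)).add
      ((hs k).const_mul (a := 2) (by norm_num))).mono
      ((((continuous_act K₁).measurable.comp_aemeasurable (hdm k)).add (hsm k)).norm.pow_const 2)
      (fun _ => by positivity) fun ω => ?_).trans (le_of_eq (by rw [hE]; ring))
    refine (sq_norm_add_le _ _).trans ?_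
    have h2 := sq_norm_act_le K₁ ((switchedTraj A B K₀ K₁ M t (fun j => w j ω) k).1 -
          linearTraj A B K₁ (fun j => w j ω) k)
    simp only [Function.comp_apply]
    linarith
  exact lqCost_sub_le hg0 hg1 hy hv hd he hfin

end Gap

end SwitchedLQR

open SwitchedLQR
theorem mainTheorem4 {n m : ℕ}
    -- plant, weights, noise covariance
    (A : Matrix (Fin n) (Fin n) ℝ) (B : Matrix (Fin n) (Fin m) ℝ)
    (Q : Matrix (Fin n) (Fin n) ℝ) (R : Matrix (Fin m) (Fin m) ℝ)
    (W : Matrix (Fin n) (Fin n) ℝ)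
    (hQ : Q.PosDef) (hR : R.PosDef) (hW : W.PosDef)
    -- independent Gaussian process noise
    {Ω : Type*} [MeasurableSpace Ω] (μ : Measure Ω) [IsProbabilityMeasure μ]
    (w : ℕ → Ω → EuclideanSpace ℝ (Fin n))
    (hw_indep : iIndepFun w μ)
    (hw_law : ∀ k, HasLaw (w k) (multivariateGaussian 0 W) μ)
    -- fallback and primary gains
    (K₀ K₁ : Matrix (Fin m) (Fin n) ℝ)
    (hK₀ : IsStabilizing A B K₀) (hK₁ : IsStabilizing A B K₁)
    -- a quadratic Lyapunov function for the primary closed loop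
    (ρ : ℝ) (P : Matrix (Fin n) (Fin n) ℝ)
    (hρ₀ : 0 < ρ) (hρ₁ : ρ < 1) (hP : P.PosDef)
    (hLyap : (ρ • P - (A + B * K₁)ᵀ * P * (A + B * K₁)).PosDef) :
    linearCost μ A B Q R K₁ w ≠ ∞ ∧
    (∀ᶠ p in regime (rateConst A B K₀ W ρ P),
      switchedCost μ A B Q R K₀ K₁ w p.1 p.2 ≠ ∞) ∧
    (fun p : ℝ × ℕ =>
        (switchedCost μ A B Q R K₀ K₁ w p.1 p.2).toReal - (linearCost μ A B Q R K₁ w).toReal)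
      =O[regime (rateConst A B K₀ W ρ P)] gapRate (rateConst A B K₀ W ρ P) := by
  rcases Nat.eq_zero_or_pos n with rfl | hn
  · -- For `n = 0` the rate constant is a division by zero, but both costs vanish.
    simp only [linearCost_eq_zero_of_isEmpty, switchedCost_eq_zero_of_isEmpty]
    exact ⟨ENNReal.zero_ne_top, Eventually.of_forall fun _ => ENNReal.zero_ne_top, by
      simpa using isBigO_zero _ _⟩
  have : NeZero n := ⟨hn.ne'⟩
  obtain ⟨hfin, C, t₀, h⟩ := exists_cost_gap_le Q R hW hw_indep hw_law hK₀ hρ₀ hρ₁ hP hLyap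
  have hev : ∀ᶠ p in regime (rateConst A B K₀ W ρ P), 0 ≤ p.1 ∧ t₀ ≤ p.2 ∧
      gapRate (rateConst A B K₀ W ρ P) p < 1 := by
    have h1 : ∀ᶠ p : ℝ × ℕ in atTop ×ˢ atTop, 0 ≤ p.1 ∧ t₀ ≤ p.2 :=
      (eventually_ge_atTop 0).prod_mk (eventually_ge_atTop t₀)
    have h2 : ∀ᶠ p in comap (gapRate (rateConst A B K₀ W ρ P)) (𝓝 0),
        gapRate (rateConst A B K₀ W ρ P) p < 1 :=
      tendsto_comap.eventually (gt_mem_nhds one_pos)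
    filter_upwards [h1.filter_mono inf_le_left, h2.filter_mono inf_le_right] with p hp1 hp2
    exact ⟨hp1.1, hp1.2, hp2⟩
  refine ⟨hfin, hev.mono fun p hp => (h p.1 hp.1 p.2 hp.2.1 hp.2.2.le).1,
    IsBigO.of_bound C (hev.mono fun p hp => ?_)⟩
  have hg0 : 0 ≤ gapRate (rateConst A B K₀ W ρ P) p := by unfold gapRate; positivity
  rw [Real.norm_eq_abs, Real.norm_of_nonneg hg0]
  exact (h p.1 hp.1 p.2 hp.2.1 hp.2.2.le).2
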